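/- Setting. Let $n$ be even and let $1<j<k\le n$. Let $s=(s_{ab})_{1\le a,b\le n}$ be complex Mandelstam invariants of massless particles: $s_{ab}=s_{ba}$ (thought of as $2p_a\cdot p_b$), $s_{aa}=0$, $\sum_b s_{ab}=0$. They lie on $(1,j,k)$ split kinematics: $s_{ab}=0$ whenever $a$ and $b$ lie strictly inside two different ones of the cyclic arcs $(1,j)$, $(j,k)$, $(k,n+1)$. CHY integrals. For a symmetric matrix $s$ of invariants of $m$ legs with zero diagonal and zero row sums, put $\mathcal S=\sum_{a<b}s_{ab}\log|a\,b|$ with $|a\,b|=\sigma_a-\sigma_b$, and fix three punctures $\sigma_p,\sigma_q,\sigma_r$ at $0,1,\infty$ (with homogeneous coordinates $(0,1),(1,1),(1,0)$). Then $$\int d\mu_m\,F:=\sum_{\sigma}\frac{(|p\,q||q\,r||r\,p|)^2\,F(\sigma)}{\det\left(\partial^2\mathcal S/\partial\sigma_a\partial\sigma_b\right)_{a,b\notin\{p,q,r\}}},$$ where the sum runs over the configurations of pairwise distinct punctures with $\partial\mathcal S/\partial\sigma_a=0$ for all $a\notin\{p,q,r\}$. Let ${\rm PT}(a_1,\dots,a_t)=1/(|a_1a_2||a_2a_3|\cdots|a_ta_1|)$,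 let $\mathbf A$ be the matrix with entries $s_{ab}/|a\,b|$ for $a\ne b$ and zero diagonal, and let $\det'\mathbf A=\det\mathbf A^{[uv]}/|u\,v|^2$, where $\mathbf A^{[uv]}$ is $\mathbf A$ without the rows and columns $u\ne v$. With $\mathbb I$ the canonical cyclic order, $$A_m^{\rm NLSM}(\mathbb I)=\int d\mu_m\,{\rm PT}(\mathbb I)\,{\det}'\mathbf A,\qquad A_m^{{\rm NLSM}\oplus\phi^3}(\mathbb I|\beta)=\int d\mu_m\,{\rm PT}(\mathbb I)\,{\rm PT}(\beta)\,\det\mathbf A_{\bar\beta},$$ where $\mathbf A_{\bar\beta}$ is $\mathbf A$ restricted to the legs not in $\beta$. Amputated currents. For consecutive on-shell legs $a,a+1,\dots,b$ (labels mod $n$) and one off-shell leg $X$ with $P_X=-(p_a+\cdots+p_b)$, in the cyclic order $(a,\dots,b,X)$, let $\hat s$ be the matrix of the invariants $2p_c\cdot p_d$ of all these legs ($c\neq d$; zero diagonal), modified for $\{x,y,z\}=\{a,b,X\}$ by replacing $2p_x\cdot p_y$ by $2p_x\cdot p_y+p_x^2+p_y^2-p_z^2$. The amputated currents $\mathcal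 J^{\rm NLSM}(a,\dots,b,X)$ and $\mathcal J^{{\rm NLSM}\oplus\phi^3}(a,\dots,b,X\,|\,a,b,X)$ are $A^{\rm NLSM}(\mathbb I)$ and $A^{{\rm NLSM}\oplus\phi^3}(\mathbb I|\beta)$, with $\beta=(a,b,X)$, evaluated at $\hat s$. Write $K,I,J$ for the off-shell legs with $P_K=-(p_1+\cdots+p_j)$, $P_I=-(p_j+\cdots+p_k)$, $P_J=-(p_k+\cdots+p_n+p_1)$. Claim. Let $A_n^{\rm NLSM}(\mathbb I)$ be computed at $s$ with any three punctures fixed and any two rows and columns removed. (0) If $j$ and $k$ are both odd, then $A_n^{\rm NLSM}(\mathbb I)=0$. For the other parities assume in addition that $s$ is generic in the following sense. In the gauge $(\sigma_1,\sigma_j,\sigma_k)=(0,1,\infty)$, consider any critical point of $\mathcal S$ at which the punctures of every two labels that do not lie in the interiors of two different arcs are distinct; then the punctures of labels in the interiors of two different arcs (whose $s_{ab}$ vanishes) are distinct too. (1) If $j$ is odd and $k$ is even, then $$A_n^{\rm NLSM}(\mathbb I)=\mathcal J_{j+1}^{\rm NLSM}(1,\dots,j,K)\;\mathcal J_{k-j+2}^{{\rm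 NLSM}\oplus\phi^3}(j,\dots,k,I\,|\,I,j,k)\;\mathcal J_{n-k+3}^{{\rm NLSM}\oplus\phi^3}(k,\dots,n,1,J\,|\,1,J,k).$$ (2) If $j$ and $k$ are both even, then $$A_n^{\rm NLSM}(\mathbb I)=\mathcal J_{j+1}^{{\rm NLSM}\oplus\phi^3}(1,\dots,j,K\,|\,1,j,K)\;\mathcal J_{k-j+2}^{\rm NLSM}(j,\dots,k,I)\;\mathcal J_{n-k+3}^{{\rm NLSM}\oplus\phi^3}(k,\dots,n,1,J\,|\,1,J,k).$$ (3) If $j$ is even and $k$ is odd, then $$A_n^{\rm NLSM}(\mathbb I)=\mathcal J_{j+1}^{{\rm NLSM}\oplus\phi^3}(1,\dots,j,K\,|\,1,j,K)\;\mathcal J_{k-j+2}^{{\rm NLSM}\oplus\phi^3}(j,\dots,k,I\,|\,I,j,k)\;\mathcal J_{n-k+3}^{\rm NLSM}(k,\dots,n,1,J).$$ -/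

import Mathlib

open scoped Matrix

namespace CHY

/-! Kinematics. Particles are labelled by `ZMod n`: particle `a` of `{1, …, n}` is the class of `a`,
and the canonical (planar) cyclic ordering is `a ↦ a + 1`. -/

/-- A matrix of Mandelstam invariants `s a b = 2 p_a · p_b` of massless particles: symmetric, with
zero diagonal, and subject to momentum conservation. -/
structure IsMandelstam {ι : Type*} [Fintype ι] (s : Matrix ι ι ℂ) : Prop where
  symm : ∀ a b, s a b = s b a
  massless : ∀ a, s a a = 0
  conservation : ∀ a, ∑ b, s a b = 0

/-- The pair of particles `(a, b)` interlaces the triple `(1, j, k)`: `a` and `b` lie strictly inside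
two different ones of the three cyclic arcs `(1, j)`, `(j, k)`, `(k, n + 1)`. -/
def Interlaces (n j k : ℕ) (a b : ZMod n) : Prop :=
  ∃ x y : ℕ, ((a = x ∧ b = y) ∨ (a = y ∧ b = x)) ∧
    ((1 < x ∧ x < j ∧ j < y ∧ y < k) ∨
     (j < x ∧ x < k ∧ k < y ∧ y ≤ n) ∨
     (1 < x ∧ x < j ∧ k < y ∧ y ≤ n))

/-- `(1, j, k)` split kinematics. -/
def IsSplit {n : ℕ} (j k : ℕ) (s : Matrix (ZMod n) (ZMod n) ℂ) : Prop :=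
  ∀ a b, Interlaces n j k a b → s a b = 0

/-! Punctures on the projective line. -/

section Punctures

variable {ι : Type*} [Fintype ι] [DecidableEq ι]

/-- The labels whose punctures are not fixed when `p`, `q`, `r` are. -/
abbrev Free (p q r : ι) : Type _ := {a : ι // a ≠ p ∧ a ≠ q ∧ a ≠ r}

/-- Homogeneous coordinates of the punctures in the gauge `σ_p = 0`, `σ_q = 1`, `σ_r = ∞`:
the column of a finite puncture `σ` is `(σ, 1)` and that of `∞` is `(1, 0)`. -/
def puncture (p q r : ι) (z : Free p q r → ℂ) (a : ι) : ℂ × ℂ :=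
  if hp : a = p then (0, 1)
  else if hq : a = q then (1, 1)
  else if hr : a = r then (1, 0)
  else (z ⟨a, hp, hq, hr⟩, 1)

/-- The Plücker coordinate `|a b|`, equal to `σ_a - σ_b` for finite punctures. -/
def bracket (c : ι → ℂ × ℂ) (a b : ι) : ℂ :=
  (c a).1 * (c b).2 - (c b).1 * (c a).2

/-- `∂S/∂σ_a` for the potential `S = ∑_{a < b} s_{ab} log |a b|`; the terms that contain the
puncture at `∞` drop out. -/
noncomputable def gradient (s : Matrix ι ι ℂ) (c : ι → ℂ × ℂ) (a : ι) : ℂ :=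
  ∑ b ∈ Finset.univ.erase a, s a b * (c b).2 / bracket c a b

/-- `∂²S/∂σ_a∂σ_b`, over the free punctures. -/
noncomputable def hessian (s : Matrix ι ι ℂ) (p q r : ι) (z : Free p q r → ℂ) :
    Matrix (Free p q r) (Free p q r) ℂ := fun a b =>
  let c := puncture p q r z
  if a = b then - ∑ d ∈ Finset.univ.erase a.1, s a d * (c d).2 ^ 2 / bracket c a d ^ 2
  else s a b / bracket c a b ^ 2

/-- The solutions of the scattering equations: gauge-fixed configurations of pairwise distinct
punctures (points of `M_{0,n}`) that are critical points of the potential. -/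
def solutions (s : Matrix ι ι ℂ) (p q r : ι) : Set (Free p q r → ℂ) :=
  {z | (∀ a b, a ≠ b → bracket (puncture p q r z) a b ≠ 0) ∧
    ∀ a : Free p q r, gradient s (puncture p q r z) a = 0}

/-- The CHY integral `∫ ∏_a' dσ_a δ(∂S/∂σ_a) (|p q||q r||r p|)² F`: the delta functions localize it
to the sum over the solutions of the scattering equations, weighted by the inverse Jacobian. -/
noncomputable def chyIntegral (s : Matrix ι ι ℂ) (p q r : ι) (F : (ι → ℂ × ℂ) → ℂ) : ℂ :=
  ∑ᶠ z ∈ solutions s p q r,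
    (bracket (puncture p q r z) p q * bracket (puncture p q r z) q r *
      bracket (puncture p q r z) r p) ^ 2 * F (puncture p q r z) / (hessian s p q r z).det

/-- The matrix `A` with entries `s_{ab} / |a b|`. -/
noncomputable def matrixA (s : Matrix ι ι ℂ) (c : ι → ℂ × ℂ) : Matrix ι ι ℂ := fun a b =>
  if a = b then 0 else s a b / bracket c a b

/-- The principal submatrix of `M` on the labels that satisfy `P`. -/
def principal (M : Matrix ι ι ℂ) (P : ι → Prop) : Matrix {a // P a} {a // P a} ℂ :=
  M.submatrix Subtype.val Subtype.val

/-- The reduced determinant `det' A = det A^{[u v]} / |u v|²`. -/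
noncomputable def reducedDet (s : Matrix ι ι ℂ) (u v : ι) (c : ι → ℂ × ℂ) : ℂ :=
  (principal (matrixA s c) (fun a => a ≠ u ∧ a ≠ v)).det / bracket c u v ^ 2

/-- The Parke–Taylor factor of a cyclically ordered list of labels. -/
noncomputable def parkeTaylor (β : List ι) (c : ι → ℂ × ℂ) : ℂ :=
  ((List.zipWith (bracket c) β (β.rotate 1)).prod)⁻¹

/-- Naculich's modification for off-shell legs among `i`, `j`, `k`. Here `G a b = 2 p_a · p_b`
(so `G a a = 2 p_a²`), and the invariant of a pair of two of the three legs is shifted: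
`2 p_i · p_j` becomes `2 p_i · p_j + p_i² + p_j² - p_k²`, and cyclically. -/
noncomputable def naculich (G : Matrix ι ι ℂ) (i j k : ι) : Matrix ι ι ℂ := fun a b =>
  if a = b then 0
  else if s(a, b) = s(i, j) then G a b + (G i i + G j j - G k k) / 2
  else if s(a, b) = s(j, k) then G a b + (G j j + G k k - G i i) / 2
  else if s(a, b) = s(k, i) then G a b + (G k k + G i i - G j j) / 2
  else G a b

end Punctures

/-! Amplitudes and amputated currents. -/

section Amplitudes

/-- The Parke–Taylor factor of the canonical ordering. -/
noncomputable def parkeTaylorCanonical {m : ℕ} [NeZero m] (c : ZMod m → ℂ × ℂ) : ℂ :=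
  ∏ a, (bracket c a (a + 1))⁻¹

/-- The NLSM partial amplitude in canonical ordering, in the gauge
`(σ_p, σ_q, σ_r) = (0, 1, ∞)` and with rows and columns `u`, `v` removed in the reduced
determinant. -/
noncomputable def nlsmAmplitude {m : ℕ} [NeZero m] (s : Matrix (ZMod m) (ZMod m) ℂ)
    (p q r u v : ZMod m) : ℂ :=
  chyIntegral s p q r fun c => parkeTaylorCanonical c * reducedDet s u v c

/-- The mixed NLSM⊕φ³ partial amplitude, in canonical ordering, whose biadjoint scalars are the
particles in `β`, ordered by `β` in the second flavour group. -/
noncomputable def mixedAmplitude {m : ℕ} [NeZero m] (s : Matrix (ZMod m) (ZMod m) ℂ)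
    (β : List (ZMod m)) (p q r : ZMod m) : ℂ :=
  chyIntegral s p q r fun c =>
    parkeTaylorCanonical c * parkeTaylor β c * (principal (matrixA s c) (fun a => a ∉ β)).det

variable {n : ℕ} [NeZero n]

/-- The momenta of the `l + 3` legs of a current with on-shell legs `a, a + 1, …, a + l + 1`, as
combinations of the momenta `p_1, …, p_n`. Leg `0` is the off-shell one, with momentum
`-(p_a + ⋯ + p_{a + l + 1})`; leg `t` with `1 ≤ t ≤ l + 2` is particle `a + t - 1`. So the
cyclic order of the legs is (off-shell, `a`, …, `a + l + 1`); the first on-shell leg is `1` and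
the last one is `-1`. -/
def legMomentum (a l : ℕ) (t : ZMod (l + 3)) : ZMod n → ℂ :=
  if t = 0 then - ∑ i ∈ Finset.range (l + 2), Pi.single ((a + i : ℕ) : ZMod n) 1
  else Pi.single ((a + (t.val - 1) : ℕ) : ZMod n) 1

/-- The products `2 p_t · p_u` of the momenta of the legs of that current. -/
def legGram (s : Matrix (ZMod n) (ZMod n) ℂ) (a l : ℕ) :
    Matrix (ZMod (l + 3)) (ZMod (l + 3)) ℂ := fun t u =>
  legMomentum a l t ⬝ᵥ (s *ᵥ legMomentum a l u)

/-- The invariants in the potential of that current: Naculich's modification for the triple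
(first on-shell leg, last on-shell leg, off-shell leg). -/
noncomputable def currentInvariants (s : Matrix (ZMod n) (ZMod n) ℂ) (a l : ℕ) :
    Matrix (ZMod (l + 3)) (ZMod (l + 3)) ℂ :=
  naculich (legGram s a l) 1 (-1) 0

/-- The NLSM amputated current with `l + 3` legs: the on-shell legs `a, a + 1, …, a + l + 1` and one
off-shell leg. -/
noncomputable def nlsmCurrent (s : Matrix (ZMod n) (ZMod n) ℂ) (a l : ℕ) : ℂ :=
  nlsmAmplitude (currentInvariants s a l) 1 (-1) 0 1 0

/-- The mixed NLSM⊕φ³ amputated current with `l + 3` legs: the on-shell legs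
`a, a + 1, …, a + l + 1` and one off-shell leg. The biadjoint scalars are the first on-shell leg,
the last one and the off-shell one, in this cyclic order. -/
noncomputable def mixedCurrent (s : Matrix (ZMod n) (ZMod n) ℂ) (a l : ℕ) : ℂ :=
  mixedAmplitude (currentInvariants s a l) [1, -1, 0] 1 (-1) 0

/-- Genericity on split kinematics: no two punctures `σ_a`, `σ_b` with `(a, b)` interlacing
`(1, j, k)`, hence with `s a b = 0` and no term `log |a b|` in the potential, collide accidentally
at a critical point of the potential. -/
def NoAccidentalCollision (j k : ℕ) (s : Matrix (ZMod n) (ZMod n) ℂ) : Prop :=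
  ∀ z : Free (1 : ZMod n) (j : ZMod n) (k : ZMod n) → ℂ,
    (∀ a b, a ≠ b → ¬ Interlaces n j k a b → bracket (puncture 1 (j : ZMod n) k z) a b ≠ 0) →
    (∀ a : Free (1 : ZMod n) (j : ZMod n) (k : ZMod n),
      gradient s (puncture 1 (j : ZMod n) k z) a = 0) →
    ∀ a b, Interlaces n j k a b → bracket (puncture 1 (j : ZMod n) k z) a b ≠ 0

end Amplitudes

end CHY

set_option linter.unusedSectionVars false

namespace CHY

section LinearAlgebra

variable {ι : Type*} [Fintype ι] [DecidableEq ι]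

theorem det_eq_det_principal (M N : Matrix ι ι ℂ) (P : ι → Prop) [DecidablePred P]
    (hout : ∀ a, ¬ P a → ∀ b, N a b = if a = b then 1 else 0)
    (hin : ∀ a b, P a → P b → N a b = M a b) : N.det = (principal M P).det := by
  rw [Matrix.twoBlockTriangular_det N P]
  · have h1 : N.toSquareBlockProp P = principal M P := by
      ext a b
      exact hin a b a.2 b.2
    have h2 : N.toSquareBlockProp (fun a => ¬ P a) = 1 := by
      ext a b
      rw [Matrix.one_apply]
      simp only [Subtype.ext_iff]
      exact hout a a.2 b
    rw [h1, h2, Matrix.det_one, mul_one]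
  · intro a ha b hb
    rw [hout a ha, if_neg]
    rintro rfl
    exact ha hb

/-- Two rows of the adjugate are proportional to the entries of a null vector. -/
theorem adjugate_mul_of_mulVec_eq_zero (B : Matrix ι ι ℂ) (z : ι → ℂ) (h : B *ᵥ z = 0)
    (u v w : ι) : B.adjugate v w * z u = B.adjugate u w * z v := by
  have h1 : B.updateRow w (Pi.single u 1) *ᵥ z = Pi.single w (z u) := by
    ext a
    by_cases ha : a = w
    · subst ha
      simp [Matrix.mulVec]
    · have := congrFun h a
      simp only [Matrix.mulVec, Pi.zero_apply] at this
      simp [Matrix.mulVec, ha, this]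
  have h2 := congrArg (fun y => (B.updateRow w (Pi.single u 1)).adjugate *ᵥ y) h1
  simp only [Matrix.mulVec_mulVec, Matrix.adjugate_mul, Matrix.smul_mulVec, Matrix.one_mulVec,
    Matrix.mulVec_single] at h2
  have h3 := congrFun h2 v
  simp only [Pi.smul_apply, smul_eq_mul, Matrix.col_apply, Matrix.adjugate_apply,
    Matrix.updateRow_idem, MulOpposite.smul_eq_mul_unop, MulOpposite.unop_op] at h3
  simp only [Matrix.adjugate_apply]
  linear_combination -h3

/-- If `z` is a left and right null vector of `M` supported on `P`, the principal minors of `M`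
obtained by removing one more label from `P` are proportional to the squares of the entries
of `z`. -/
theorem det_principal_exchange (M : Matrix ι ι ℂ) (z : ι → ℂ) (h1 : M *ᵥ z = 0)
    (h2 : Mᵀ *ᵥ z = 0) (P Pu Pv : ι → Prop) [DecidablePred P] [DecidablePred Pu] [DecidablePred Pv]
    (hz : ∀ a, ¬ P a → z a = 0) (u v : ι)
    (hPu : ∀ a, Pu a ↔ P a ∧ a ≠ u) (hPv : ∀ a, Pv a ↔ P a ∧ a ≠ v) :
    (principal M Pu).det * z v ^ 2 = (principal M Pv).det * z u ^ 2 := by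
  let N : Matrix ι ι ℂ := fun a b => if P a ∧ P b then M a b else if a = b then 1 else 0
  have key : ∀ (w : ι) (Pw : ι → Prop) [DecidablePred Pw], (∀ a, Pw a ↔ P a ∧ a ≠ w) →
      N.adjugate w w = (principal M Pw).det := by
    intro w Pw _ hPw
    rw [Matrix.adjugate_apply]
    apply det_eq_det_principal
    · intro a ha b
      by_cases haw : a = w
      · subst haw
        simp [Pi.single_apply, eq_comm]
      · rw [Matrix.updateRow_ne haw]
        have : ¬ P a := fun h => ha ((hPw a).2 ⟨h, haw⟩)
        simp [N, this]
    · intro a b ha hb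
      rw [hPw] at ha hb
      rw [Matrix.updateRow_ne ha.2]
      simp [N, ha.1, hb.1]
  have null : ∀ (M' N' : Matrix ι ι ℂ), M' *ᵥ z = 0 →
      (∀ a b, N' a b = if P a ∧ P b then M' a b else if a = b then 1 else 0) → N' *ᵥ z = 0 := by
    intro M' N' h hN
    ext a
    by_cases ha : P a
    · rw [← h]
      apply Finset.sum_congr rfl
      intro b _
      by_cases hb : P b
      · simp [hN, ha, hb]
      · simp [hz b hb]
    · simp only [Matrix.mulVec, dotProduct, Pi.zero_apply]
      apply Finset.sum_eq_zero
      intro b _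
      rw [hN, if_neg (fun h => ha h.1)]
      split_ifs with hab
      · rw [← hab, hz a ha, mul_zero]
      · rw [zero_mul]
  have hN1 : N *ᵥ z = 0 := null M N h1 fun _ _ => rfl
  have hN2 : Nᵀ *ᵥ z = 0 := by
    apply null Mᵀ Nᵀ h2
    intro a b
    rw [Matrix.transpose_apply, Matrix.transpose_apply]
    simp only [N, and_comm (a := P b), eq_comm (a := b)]
  rw [← key u Pu hPu, ← key v Pv hPv]
  have e1 := adjugate_mul_of_mulVec_eq_zero N z hN1 v u u
  have e2 := adjugate_mul_of_mulVec_eq_zero Nᵀ z hN2 v u v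
  rw [← Matrix.adjugate_transpose, Matrix.transpose_apply, Matrix.transpose_apply] at e2
  linear_combination z v * e1 + z u * e2

theorem det_of_skew_of_odd (M : Matrix ι ι ℂ) (hM : Mᵀ = -M) (hodd : Odd (Fintype.card ι)) :
    M.det = 0 := by
  have h := Matrix.det_transpose M
  rw [hM, Matrix.det_neg, hodd.neg_one_pow] at h
  linear_combination (-1 / 2 : ℂ) * h

/-- If the labels outside `p` are even in number and couple to `p` only through the label `x`, the
determinant of a skew matrix is the product of those of its diagonal blocks. -/
theorem det_of_skew_star (M : Matrix ι ι ℂ) (hM : Mᵀ = -M) (p : ι → Prop) [DecidablePred p]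
    (x : ι) (hx : p x) (h : ∀ a b, p a → a ≠ x → ¬ p b → M a b = 0)
    (hev : Even (Fintype.card {a // ¬ p a})) :
    M.det = (principal M p).det * (principal M fun a => ¬ p a).det := by
  have hskew : ∀ a b, M a b = - M b a := fun a b => by
    have := congrFun (congrFun hM b) a
    simpa using this
  let r₁ : ι → ℂ := fun b => if p b then M x b else 0
  let r₂ : ι → ℂ := fun b => if p b then 0 else M x b
  have hr : r₁ + r₂ = M x := by
    ext b
    by_cases hb : p b <;> simp [r₁, r₂, hb]
  have hdet : M.det = (M.updateRow x r₁).det + (M.updateRow x r₂).det := by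
    rw [← Matrix.det_updateRow_add, hr, Matrix.updateRow_eq_self]
  have hfst : (M.updateRow x r₁).det
      = (principal M p).det * (principal M fun a => ¬ p a).det := by
    rw [Matrix.twoBlockTriangular_det' _ p]
    · congr 2
      · ext a b
        by_cases ha : a.1 = x
        · simp [Matrix.toSquareBlockProp, principal, ha, r₁, b.2]
        · simp [Matrix.toSquareBlockProp, principal, Matrix.updateRow_ne ha]
      · ext a b
        have ha : a.1 ≠ x := fun e => a.2 (e ▸ hx)
        simp [Matrix.toSquareBlockProp, principal, Matrix.updateRow_ne ha]
    · intro a ha b hb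
      by_cases hax : a = x
      · subst hax
        simp [r₁, hb]
      · rw [Matrix.updateRow_ne hax, h a b ha hax hb]
  have hsnd : (M.updateRow x r₂).det = 0 := by
    rw [Matrix.twoBlockTriangular_det _ fun a => p a ∧ a ≠ x]
    · convert mul_zero _
      apply det_of_skew_of_odd
      · ext ⟨a, ha⟩ ⟨b, hb⟩
        simp only [Matrix.toSquareBlockProp, Matrix.transpose_apply, Matrix.neg_apply]
        have hxx : M x x = 0 := by linear_combination (1 / 2 : ℂ) * hskew x x
        by_cases hax : a = x <;> by_cases hbx : b = x
        · subst hax hbx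
          simp [r₂, hx]
        · have : ¬ p b := fun hpb => hb ⟨hpb, hbx⟩
          subst hax
          simp [Matrix.updateRow_ne hbx, r₂, this, hskew b a]
        · have : ¬ p a := fun hpa => ha ⟨hpa, hax⟩
          subst hbx
          simp [Matrix.updateRow_ne hax, r₂, this, hskew a b]
        · simp [Matrix.updateRow_ne hax, Matrix.updateRow_ne hbx, hskew b a]
      · have hc : Fintype.card {a // ¬ (p a ∧ a ≠ x)} = Fintype.card {a // ¬ p a} + 1 := by
          rw [Fintype.card_subtype, Fintype.card_subtype,
            ← Finset.card_insert_of_notMem (a := x) (by simpa using hx)]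
          congr 1
          ext a
          simp only [Finset.mem_filter, Finset.mem_univ, true_and, Finset.mem_insert]
          tauto
        rw [hc]
        exact hev.add_one
    · intro a ha b hb
      by_cases hax : a = x
      · subst hax
        simp [r₂, hb.1]
      · have hpa : ¬ p a := fun hpa => ha ⟨hpa, hax⟩
        rw [Matrix.updateRow_ne hax, hskew, h b a hb.1 hb.2 hpa, neg_zero]
  rw [hdet, hfst, hsnd, add_zero]

theorem det_eq_of_bijective {κ : Type*} [Fintype κ] [DecidableEq κ] (M : Matrix ι ι ℂ)
    (N : Matrix κ κ ℂ) (f : κ → ι) (hf : Function.Bijective f)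
    (h : ∀ a b, N a b = M (f a) (f b)) : M.det = N.det := by
  rw [← Matrix.det_submatrix_equiv_self (Equiv.ofBijective f hf) M]
  congr 1
  ext a b
  exact (h a b).symm

/-- Rescaling rows and columns alike multiplies a principal minor by the square of the product of
the factors of its labels. -/
theorem det_principal_scale (M N : Matrix ι ι ℂ) (w : ι → ℂ)
    (h : ∀ a b, M a b = w a * N a b * w b) (P : ι → Prop) [DecidablePred P] :
    (principal M P).det * ∏ a : {a // ¬ P a}, w a ^ 2 = (∏ a, w a ^ 2) * (principal N P).det := by
  have h1 : principal M P = Matrix.of fun a b : {a // P a} =>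
      w a * (Matrix.of fun a b : {a // P a} => w b * principal N P a b) a b := by
    ext a b
    simp only [principal, Matrix.submatrix_apply, Matrix.of_apply, h]
    ring
  rw [h1, Matrix.det_mul_column, Matrix.det_mul_row,
    ← Fintype.prod_subtype_mul_prod_subtype P fun a => w a ^ 2]
  simp only [Finset.prod_pow]
  ring

end LinearAlgebra

section Gauge

variable {ι : Type*} [Fintype ι] [DecidableEq ι]

/-- The scattering equations in homogeneous coordinates: the components of the punctures are null
vectors of the matrix with entries `s a b / |a b|`. -/
structure IsCritical (s : Matrix ι ι ℂ) (c : ι → ℂ × ℂ) : Prop where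
  ne : ∀ a b, a ≠ b → bracket c a b ≠ 0
  fst : ∀ a, ∑ b, s a b * (c b).1 / bracket c a b = 0
  snd : ∀ a, ∑ b, s a b * (c b).2 / bracket c a b = 0

@[simp]
theorem bracket_self (c : ι → ℂ × ℂ) (a : ι) : bracket c a a = 0 := by
  simp [bracket]

theorem bracket_swap (c : ι → ℂ × ℂ) (a b : ι) : bracket c b a = - bracket c a b := by
  simp only [bracket]
  ring

theorem gradient_eq_sum (s : Matrix ι ι ℂ) (c : ι → ℂ × ℂ) (a : ι) :
    gradient s c a = ∑ b, s a b * (c b).2 / bracket c a b := by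
  rw [gradient, Finset.sum_erase]
  simp

theorem sum_sum_eq_zero_of_skew (f : ι → ι → ℂ) (h : ∀ a b, f a b = - f b a) :
    ∑ a, ∑ b, f a b = 0 := by
  have h1 : ∑ a, ∑ b, f a b = ∑ a, ∑ b, f b a := Finset.sum_comm
  have h2 : ∑ a, ∑ b, f a b = - ∑ a, ∑ b, f b a := by
    simp only [← Finset.sum_neg_distrib]
    exact Finset.sum_congr rfl fun a _ => Finset.sum_congr rfl fun b _ => h a b
  linear_combination (1 / 2 : ℂ) * h1 + (1 / 2 : ℂ) * h2

@[simp]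
theorem puncture_fst (p q r : ι) (z : Free p q r → ℂ) : puncture p q r z p = (0, 1) := by
  simp [puncture]

theorem puncture_snd {p q r : ι} (hpq : p ≠ q) (z : Free p q r → ℂ) :
    puncture p q r z q = (1, 1) := by
  simp [puncture, hpq.symm]

theorem puncture_thd {p q r : ι} (hqr : q ≠ r) (hrp : r ≠ p) (z : Free p q r → ℂ) :
    puncture p q r z r = (1, 0) := by
  simp [puncture, hqr.symm, hrp]

theorem puncture_free {p q r : ι} (z : Free p q r → ℂ) (a : Free p q r) :
    puncture p q r z a = (z a, 1) := by
  simp [puncture, a.2.1, a.2.2.1, a.2.2.2]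

theorem bracket_gauge {p q r : ι} (hpq : p ≠ q) (hqr : q ≠ r) (hrp : r ≠ p)
    (z : Free p q r → ℂ) : bracket (puncture p q r z) p q = -1 ∧
      bracket (puncture p q r z) q r = -1 ∧ bracket (puncture p q r z) r p = 1 := by
  simp [bracket, puncture_snd hpq, puncture_thd hqr hrp]

theorem mem_solutions_iff {s : Matrix ι ι ℂ} (hs : IsMandelstam s) {p q r : ι} (hpq : p ≠ q)
    (hqr : q ≠ r) (hrp : r ≠ p) (z : Free p q r → ℂ) :
    z ∈ solutions s p q r ↔ IsCritical s (puncture p q r z) := by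
  constructor
  · rintro ⟨hne, hgrad⟩
    set c := puncture p q r z with hc
    have hcp : c p = (0, 1) := puncture_fst p q r z
    have hcq : c q = (1, 1) := puncture_snd hpq z
    have hcr : c r = (1, 0) := puncture_thd hqr hrp z
    let x : ι → ℂ := fun a => ∑ b, s a b * (c b).1 / bracket c a b
    let y : ι → ℂ := fun a => ∑ b, s a b * (c b).2 / bracket c a b
    have hrel : ∀ a, (c a).2 * x a = (c a).1 * y a := by
      intro a
      have : (c a).2 * x a - (c a).1 * y a = - ∑ b, s a b := by
        simp only [x, y, Finset.mul_sum, ← Finset.sum_sub_distrib, ← Finset.sum_neg_distrib]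
        refine Finset.sum_congr rfl fun b _ => ?_
        by_cases hab : a = b
        · subst hab
          simp [hs.massless]
        · have := hne a b hab
          field_simp
          simp only [bracket]
          ring
      rw [hs.conservation, neg_zero, sub_eq_zero] at this
      exact this
    have hskew : ∀ f g : ι → ℂ, ∑ a, f a * ∑ b, s a b * g b / bracket c a b
        = - ∑ a, g a * ∑ b, s a b * f b / bracket c a b := by
      intro f g
      rw [← sub_eq_zero, sub_neg_eq_add]
      simp only [Finset.mul_sum, ← Finset.sum_add_distrib]
      apply sum_sum_eq_zero_of_skew
      intro a b
      rw [bracket_swap c a b, hs.symm b a]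
      ring
    have h11 : ∑ a, (c a).1 * x a = 0 := by
      have := hskew (fun a => (c a).1) (fun a => (c a).1)
      linear_combination (1 / 2 : ℂ) * this
    have h22 : ∑ a, (c a).2 * y a = 0 := by
      have := hskew (fun a => (c a).2) (fun a => (c a).2)
      linear_combination (1 / 2 : ℂ) * this
    have h12 : ∑ a, (c a).1 * y a = 0 := by
      have h := hskew (fun a => (c a).1) (fun a => (c a).2)
      have h' : ∑ a, (c a).2 * x a = ∑ a, (c a).1 * y a :=
        Finset.sum_congr rfl fun a _ => hrel a
      linear_combination (1 / 2 : ℂ) * h - (1 / 2 : ℂ) * h'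
    have hyr : y r = 0 := by
      have := hrel r
      rw [hcr] at this
      simpa using this.symm
    have hy : ∀ a, a ≠ p → a ≠ q → y a = 0 := by
      intro a hap haq
      by_cases har : a = r
      · rw [har, hyr]
      · have := hgrad ⟨a, hap, haq, har⟩
        rwa [gradient_eq_sum] at this
    have hyq : y q = 0 := by
      rw [Finset.sum_eq_single q] at h12
      · simpa [hcq] using h12
      · intro a _ haq
        by_cases hap : a = p
        · simp [hap, hcp]
        · simp [hy a hap haq]
      · simp
    have hyp : y p = 0 := by
      rw [Finset.sum_eq_single p] at h22
      · simpa [hcp] using h22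
      · intro a _ hap
        by_cases haq : a = q
        · simp [haq, hyq]
        · simp [hy a hap haq]
      · simp
    have hyall : ∀ a, y a = 0 := by
      intro a
      by_cases hap : a = p
      · rw [hap, hyp]
      by_cases haq : a = q
      · rw [haq, hyq]
      exact hy a hap haq
    have hx : ∀ a, a ≠ r → x a = 0 := by
      intro a har
      have h := hrel a
      rw [hyall, mul_zero] at h
      refine (mul_eq_zero.1 h).resolve_left ?_
      have := hne a r har
      rw [bracket, hcr] at this
      intro h0
      simp [h0] at this
    have hxr : x r = 0 := by
      rw [Finset.sum_eq_single r] at h11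
      · simpa [hcr] using h11
      · intro a _ har
        simp [hx a har]
      · simp
    refine ⟨hne, fun a => ?_, hyall⟩
    by_cases har : a = r
    · rw [har]
      exact hxr
    · exact hx a har
  · intro h
    refine ⟨h.ne, fun a => ?_⟩
    rw [gradient_eq_sum]
    exact h.snd a

/-- `c'` is obtained from `c` by a unimodular Möbius transformation, up to a rescaling of the
homogeneous coordinates of each puncture by `t`. -/
def IsMoebius (t : ι → ℂ) (c c' : ι → ℂ × ℂ) : Prop :=
  (∀ a, t a ≠ 0) ∧ ∃ α β γ δ : ℂ, α * δ - β * γ = 1 ∧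
    ∀ a, c' a = (t a * (α * (c a).1 + β * (c a).2), t a * (γ * (c a).1 + δ * (c a).2))

theorem IsMoebius.bracket {t : ι → ℂ} {c c' : ι → ℂ × ℂ} (h : IsMoebius t c c') (a b : ι) :
    bracket c' a b = t a * t b * bracket c a b := by
  obtain ⟨-, α, β, γ, δ, hdet, hc⟩ := h
  simp only [CHY.bracket, hc]
  linear_combination (t a * t b * ((c a).1 * (c b).2 - (c b).1 * (c a).2)) * hdet

theorem IsMoebius.isCritical {s : Matrix ι ι ℂ} {t : ι → ℂ} {c c' : ι → ℂ × ℂ}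
    (h : IsMoebius t c c') (hc : IsCritical s c) : IsCritical s c' := by
  have hb := h.bracket
  obtain ⟨ht, α, β, γ, δ, -, hc'⟩ := h
  have key : ∀ (κ μ : ℂ) (a : ι), ∑ b, s a b * (t b * (κ * (c b).1 + μ * (c b).2)) /
      CHY.bracket c' a b = 0 := by
    intro κ μ a
    have : ∑ b, s a b * (t b * (κ * (c b).1 + μ * (c b).2)) / CHY.bracket c' a b
        = (t a)⁻¹ * (κ * ∑ b, s a b * (c b).1 / CHY.bracket c a b
          + μ * ∑ b, s a b * (c b).2 / CHY.bracket c a b) := by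
      simp only [Finset.mul_sum, ← Finset.sum_add_distrib]
      refine Finset.sum_congr rfl fun b _ => ?_
      by_cases hab : a = b
      · subst hab
        simp
      · have h1 := hc.ne a b hab
        have h2 := ht a
        have h3 := ht b
        rw [hb]
        field_simp
    rw [this, hc.fst, hc.snd]
    simp
  refine ⟨fun a b hab => ?_, fun a => ?_, fun a => ?_⟩
  · rw [hb]
    exact mul_ne_zero (mul_ne_zero (ht a) (ht b)) (hc.ne a b hab)
  · convert key α β a using 4 with b
    rw [hc']
  · convert key γ δ a using 4 with b
    rw [hc']

/-- The Hessian of the potential in homogeneous coordinates. -/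
noncomputable def homogeneousHessian (s : Matrix ι ι ℂ) (c : ι → ℂ × ℂ) : Matrix ι ι ℂ :=
  fun a b =>
    if a = b then
      if (c a).2 = 0 then - (∑ d, s a d * (c d).1 ^ 2 / bracket c a d ^ 2) / (c a).1 ^ 2
      else - (∑ d, s a d * (c d).2 ^ 2 / bracket c a d ^ 2) / (c a).2 ^ 2
    else s a b / bracket c a b ^ 2

theorem homogeneousHessian_mulVec (s : Matrix ι ι ℂ) (c : ι → ℂ × ℂ) (Q : ι → ℂ) (a : ι) :
    (homogeneousHessian s c *ᵥ Q) a =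
      homogeneousHessian s c a a * Q a + ∑ b, s a b * Q b / bracket c a b ^ 2 := by
  have : homogeneousHessian s c a a * Q a
      = ∑ b, if a = b then homogeneousHessian s c a b * Q b else 0 := by simp
  rw [this, ← Finset.sum_add_distrib]
  refine Finset.sum_congr rfl fun b _ => ?_
  by_cases hab : a = b
  · subst hab
    simp
  · simp only [homogeneousHessian, if_neg hab]
    ring

theorem homogeneousHessian_mulVec_quadratic {s : Matrix ι ι ℂ} {c : ι → ℂ × ℂ}
    (hc : IsCritical s c) (κ μ ν : ℂ) :
    homogeneousHessian s c *ᵥ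
      (fun b => κ * (c b).1 ^ 2 + μ * ((c b).1 * (c b).2) + ν * (c b).2 ^ 2) = 0 := by
  ext a
  rw [homogeneousHessian_mulVec, Pi.zero_apply]
  by_cases hy : (c a).2 = 0
  · by_cases hx : (c a).1 = 0
    · simp [hx, hy, bracket]
    · simp only [homogeneousHessian, if_true, if_pos hy]
      have key : ∑ b, s a b * (κ * (c b).1 ^ 2 + μ * ((c b).1 * (c b).2) + ν * (c b).2 ^ 2)
            / bracket c a b ^ 2 * (c a).1 ^ 2
          - ∑ b, s a b * (c b).1 ^ 2 / bracket c a b ^ 2 * (κ * (c a).1 ^ 2) =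
          μ * (c a).1 * ∑ b, s a b * (c b).1 / bracket c a b
          + ν * (c a).1 * ∑ b, s a b * (c b).2 / bracket c a b := by
        simp only [Finset.mul_sum, ← Finset.sum_sub_distrib, ← Finset.sum_add_distrib]
        refine Finset.sum_congr rfl fun b _ => ?_
        by_cases hab : a = b
        · subst hab
          simp
        · have := hc.ne a b hab
          field_simp
          simp only [bracket, hy]
          ring
      rw [hc.fst, hc.snd, ← Finset.sum_mul, ← Finset.sum_mul] at key
      rw [hy]
      generalize (∑ b, s a b * (κ * (c b).1 ^ 2 + μ * ((c b).1 * (c b).2) + ν * (c b).2 ^ 2)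
            / bracket c a b ^ 2) = S at key ⊢
      field_simp
      linear_combination key
  · simp only [homogeneousHessian, if_true, if_neg hy]
    have key : ∑ b, s a b * (κ * (c b).1 ^ 2 + μ * ((c b).1 * (c b).2) + ν * (c b).2 ^ 2)
          / bracket c a b ^ 2 * (c a).2 ^ 2
        - ∑ b, s a b * (c b).2 ^ 2 / bracket c a b ^ 2 *
          (κ * (c a).1 ^ 2 + μ * ((c a).1 * (c a).2) + ν * (c a).2 ^ 2) =
        - (κ * (c a).2 * ∑ b, s a b * (c b).1 / bracket c a b
        + (κ * (c a).1 + μ * (c a).2) * ∑ b, s a b * (c b).2 / bracket c a b) := by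
      simp only [Finset.mul_sum, ← Finset.sum_sub_distrib, ← Finset.sum_add_distrib,
        ← Finset.sum_neg_distrib]
      refine Finset.sum_congr rfl fun b _ => ?_
      by_cases hab : a = b
      · subst hab
        simp
      · have := hc.ne a b hab
        field_simp
        simp only [bracket]
        ring
    rw [hc.fst, hc.snd, ← Finset.sum_mul, ← Finset.sum_mul] at key
    generalize (∑ b, s a b * (κ * (c b).1 ^ 2 + μ * ((c b).1 * (c b).2) + ν * (c b).2 ^ 2)
          / bracket c a b ^ 2) = S at key ⊢
    field_simp
    linear_combination key

theorem homogeneousHessian_transpose {s : Matrix ι ι ℂ} (hs : IsMandelstam s) (c : ι → ℂ × ℂ) :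
    (homogeneousHessian s c)ᵀ = homogeneousHessian s c := by
  ext a b
  rw [Matrix.transpose_apply]
  by_cases hab : a = b
  · rw [hab]
  · simp only [homogeneousHessian, if_neg hab, if_neg (Ne.symm hab), hs.symm b a,
      bracket_swap c a b, neg_sq]

theorem IsMoebius.homogeneousHessian [Nontrivial ι] {s : Matrix ι ι ℂ} {t : ι → ℂ}
    {c c' : ι → ℂ × ℂ} (h : IsMoebius t c c') (hc : IsCritical s c) (a b : ι) :
    CHY.homogeneousHessian s c' a b
      = (t a ^ 2)⁻¹ * CHY.homogeneousHessian s c a b * (t b ^ 2)⁻¹ := by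
  have hcrit := h.isCritical hc
  have hb := h.bracket
  obtain ⟨ht, α, β, γ, δ, -, hc'⟩ := h
  by_cases hab : a = b
  · subst hab
    have key : ∀ (κ μ : ℂ) (Q' : ι → ℂ), (∀ d, Q' d = (t d * (κ * (c d).1 + μ * (c d).2)) ^ 2) →
        (CHY.homogeneousHessian s c' *ᵥ Q') a = 0 →
        CHY.homogeneousHessian s c' a a * Q' a
          = (t a ^ 2)⁻¹ * CHY.homogeneousHessian s c a a * (t a ^ 2)⁻¹ * Q' a := by
      intro κ μ Q' hQ h0
      have h1 := congrFun (homogeneousHessian_mulVec_quadratic hc (κ ^ 2) (2 * κ * μ) (μ ^ 2)) a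
      rw [homogeneousHessian_mulVec, Pi.zero_apply] at h1
      rw [homogeneousHessian_mulVec] at h0
      have h2 : ∑ d, s a d * Q' d / CHY.bracket c' a d ^ 2 = (t a ^ 2)⁻¹ *
          ∑ d, s a d * (κ ^ 2 * (c d).1 ^ 2 + 2 * κ * μ * ((c d).1 * (c d).2)
            + μ ^ 2 * (c d).2 ^ 2) / CHY.bracket c a d ^ 2 := by
        rw [Finset.mul_sum]
        refine Finset.sum_congr rfl fun d _ => ?_
        by_cases had : a = d
        · subst had
          simp
        · have h1 := hc.ne a d had
          have h2 := ht a
          have h3 := ht d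
          rw [hb, hQ]
          field_simp
          ring
      rw [h2] at h0
      rw [hQ] at h0 ⊢
      have := ht a
      generalize (∑ d, s a d * (κ ^ 2 * (c d).1 ^ 2 + 2 * κ * μ * ((c d).1 * (c d).2)
            + μ ^ 2 * (c d).2 ^ 2) / CHY.bracket c a d ^ 2) = S at h0 h1
      field_simp at h0 ⊢
      linear_combination h0 - h1
    have key1 := key α β (fun d => (c' d).1 ^ 2) (fun d => by rw [hc']) (by
      have := homogeneousHessian_mulVec_quadratic hcrit 1 0 0
      simp only [one_mul, zero_mul, add_zero] at this
      rw [this, Pi.zero_apply])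
    have key2 := key γ δ (fun d => (c' d).2 ^ 2) (fun d => by rw [hc']) (by
      have := homogeneousHessian_mulVec_quadratic hcrit 0 0 1
      simp only [one_mul, zero_mul, zero_add] at this
      rw [this, Pi.zero_apply])
    by_cases h1 : (c' a).1 = 0
    · by_cases h2 : (c' a).2 = 0
      · obtain ⟨d, hd⟩ := exists_ne a
        exact absurd (by simp [CHY.bracket, h1, h2]) (hcrit.ne d a hd)
      · exact mul_right_cancel₀ (pow_ne_zero 2 h2) key2
    · exact mul_right_cancel₀ (pow_ne_zero 2 h1) key1
  · have h1 := hc.ne a b hab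
    have h2 := ht a
    have h3 := ht b
    simp only [CHY.homogeneousHessian, if_neg hab, hb]
    field_simp

/-- A symmetric function of three labels that is insensitive to the exchange of one label is
constant on triples of distinct labels. -/
theorem eq_of_exchange_three {α : Type*} (f : ι → ι → ι → α) (h12 : ∀ a b c, f a b c = f b a c)
    (h23 : ∀ a b c, f a b c = f a c b)
    (hex : ∀ a a' b c, a ≠ b → a ≠ c → a' ≠ b → a' ≠ c → b ≠ c → f a b c = f a' b c)
    {p q r p' q' r' : ι} (hpq : p ≠ q) (hqr : q ≠ r) (hrp : r ≠ p)
    (hpq' : p' ≠ q') (hqr' : q' ≠ r') (hrp' : r' ≠ p') : f p q r = f p' q' r' := by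
  obtain ⟨y, z, hy, hz, hyz, h1⟩ : ∃ y z, y ≠ p' ∧ z ≠ p' ∧ y ≠ z ∧ f p q r = f p' y z := by
    by_cases h1 : p' = q
    · exact ⟨p, r, h1 ▸ hpq, h1 ▸ hqr.symm, hrp.symm, h1 ▸ h12 p q r⟩
    by_cases h2 : p' = r
    · subst h2
      exact ⟨p, q, hrp.symm, hqr, hpq, by rw [h23 p q, h12 p]⟩
    exact ⟨q, r, Ne.symm h1, Ne.symm h2, hqr, hex p p' q r hpq hrp.symm h1 h2 hqr⟩
  obtain ⟨w, hw, hwq, h2⟩ : ∃ w, w ≠ p' ∧ w ≠ q' ∧ f p' y z = f p' q' w := by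
    by_cases h1 : q' = z
    · exact ⟨y, hy, h1 ▸ hyz, h1 ▸ h23 p' y z⟩
    · refine ⟨z, hz, Ne.symm h1, ?_⟩
      rw [h12 p' y z, h12 p' q' z]
      exact hex y q' p' z hy hyz hpq'.symm h1 hz.symm
  rw [h1, h2, h23 p' q' w, h12 p' w q', h23 p' q' r', h12 p' r' q']
  exact hex w r' p' q' hw hwq hrp' hqr'.symm hpq'

theorem det_hessian_gauge {s : Matrix ι ι ℂ} (hs : IsMandelstam s) {c : ι → ℂ × ℂ}
    (hc : IsCritical s c) {p q r p' q' r' : ι} (hpq : p ≠ q) (hqr : q ≠ r) (hrp : r ≠ p)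
    (hpq' : p' ≠ q') (hqr' : q' ≠ r') (hrp' : r' ≠ p') :
    (principal (homogeneousHessian s c) (fun a => a ≠ p ∧ a ≠ q ∧ a ≠ r)).det /
        (bracket c p q * bracket c q r * bracket c r p) ^ 2 =
      (principal (homogeneousHessian s c) (fun a => a ≠ p' ∧ a ≠ q' ∧ a ≠ r')).det /
        (bracket c p' q' * bracket c q' r' * bracket c r' p') ^ 2 := by
  refine eq_of_exchange_three (fun p q r =>
    (principal (homogeneousHessian s c) (fun a => a ≠ p ∧ a ≠ q ∧ a ≠ r)).det /
        (bracket c p q * bracket c q r * bracket c r p) ^ 2) ?_ ?_ ?_ hpq hqr hrp hpq' hqr' hrp'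
  · intro a b d
    have e : (fun x => x ≠ a ∧ x ≠ b ∧ x ≠ d) = (fun x => x ≠ b ∧ x ≠ a ∧ x ≠ d) := by
      ext x; tauto
    congr 1
    · exact det_eq_of_bijective _ _ (Equiv.subtypeEquivRight fun x => by tauto)
        (Equiv.bijective _) fun _ _ => rfl
    · rw [bracket_swap c b a, bracket_swap c d b, bracket_swap c a d]
      ring
  · intro a b d
    congr 1
    · exact det_eq_of_bijective _ _ (Equiv.subtypeEquivRight fun x => by tauto)
        (Equiv.bijective _) fun _ _ => rfl
    · rw [bracket_swap c b a, bracket_swap c d b, bracket_swap c a d]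
      ring
  · intro a a' b d hab had hab' had' hbd
    have h1 : homogeneousHessian s c *ᵥ (fun x => bracket c x b * bracket c x d) = 0 := by
      convert homogeneousHessian_mulVec_quadratic hc ((c b).2 * (c d).2)
        (- ((c b).2 * (c d).1 + (c b).1 * (c d).2)) ((c b).1 * (c d).1) using 2
      ext x
      simp only [bracket]
      ring
    have h2 := det_principal_exchange (homogeneousHessian s c) _ h1
      (by rw [homogeneousHessian_transpose hs, h1]) (fun x => x ≠ b ∧ x ≠ d)
      (fun x => x ≠ a ∧ x ≠ b ∧ x ≠ d) (fun x => x ≠ a' ∧ x ≠ b ∧ x ≠ d)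
      (fun x hx => by
        rw [not_and_or, not_not, not_not] at hx
        rcases hx with rfl | rfl <;> simp) a a' (fun x => by tauto) (fun x => by tauto)
    have n1 := hc.ne a b hab
    have n2 := hc.ne b d hbd
    have n3 := hc.ne a d had
    have n4 := hc.ne a' b hab'
    have n5 := hc.ne a' d had'
    simp only [bracket_swap c a d, bracket_swap c a' d]
    rw [div_eq_div_iff (by simp [n1, n2, n3]) (by simp [n2, n4, n5])]
    linear_combination bracket c b d ^ 2 * h2

end Gauge

section GaugeIndependence

variable {ι : Type*} [Fintype ι] [DecidableEq ι]

theorem hessian_eq_principal (s : Matrix ι ι ℂ) (p q r : ι) (z : Free p q r → ℂ) :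
    hessian s p q r z = principal (homogeneousHessian s (puncture p q r z))
      (fun a => a ≠ p ∧ a ≠ q ∧ a ≠ r) := by
  ext a b
  simp only [hessian, principal, Matrix.submatrix_apply, homogeneousHessian, Subtype.ext_iff]
  by_cases hab : (a : ι) = b
  · rw [if_pos hab, if_pos hab, puncture_free z a, if_neg one_ne_zero, Finset.sum_erase]
    · simp
    · simp
  · rw [if_neg hab, if_neg hab]

theorem prod_not_ne_and_ne (f : ι → ℂ) {u v : ι} (huv : u ≠ v) :
    ∏ a : {a // ¬ (a ≠ u ∧ a ≠ v)}, f a = f u * f v := by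
  rw [← Finset.prod_subtype {u, v} (fun x => by simp; tauto) f, Finset.prod_pair huv]

theorem prod_not_ne_and_ne_and_ne (f : ι → ℂ) {p q r : ι} (hpq : p ≠ q) (hqr : q ≠ r)
    (hrp : r ≠ p) : ∏ a : {a // ¬ (a ≠ p ∧ a ≠ q ∧ a ≠ r)}, f a = f p * f q * f r := by
  rw [← Finset.prod_subtype {p, q, r} (fun x => by simp; tauto) f,
    Finset.prod_insert (by simp [hpq, hrp.symm]), Finset.prod_pair hqr, mul_assoc]

theorem IsMoebius.det_hessian [Nontrivial ι] {s : Matrix ι ι ℂ} {t : ι → ℂ} {c c' : ι → ℂ × ℂ}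
    (h : IsMoebius t c c') (hc : IsCritical s c) {p q r : ι} (hpq : p ≠ q) (hqr : q ≠ r)
    (hrp : r ≠ p) :
    (principal (CHY.homogeneousHessian s c') (fun a => a ≠ p ∧ a ≠ q ∧ a ≠ r)).det /
        (CHY.bracket c' p q * CHY.bracket c' q r * CHY.bracket c' r p) ^ 2 * ∏ a, t a ^ 4 =
      (principal (CHY.homogeneousHessian s c) (fun a => a ≠ p ∧ a ≠ q ∧ a ≠ r)).det /
        (CHY.bracket c p q * CHY.bracket c q r * CHY.bracket c r p) ^ 2 := by
  have h1 := det_principal_scale _ _ (fun a => (t a ^ 2)⁻¹) (h.homogeneousHessian hc)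
    (fun a => a ≠ p ∧ a ≠ q ∧ a ≠ r)
  rw [prod_not_ne_and_ne_and_ne (fun a => ((t a ^ 2)⁻¹) ^ 2) hpq hqr hrp] at h1
  have h2 : ∏ a, ((t a ^ 2)⁻¹) ^ 2 = (∏ a, t a ^ 4)⁻¹ := by
    rw [← Finset.prod_inv_distrib]
    refine Finset.prod_congr rfl fun a _ => ?_
    rw [inv_pow, ← pow_mul]
  rw [h2] at h1
  have h3 : ∏ a, t a ^ 4 ≠ 0 := Finset.prod_ne_zero_iff.2 fun a _ => pow_ne_zero 4 (h.1 a)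
  have tp := h.1 p
  have tq := h.1 q
  have tr := h.1 r
  have n1 := hc.ne p q hpq
  have n2 := hc.ne q r hqr
  have n3 := hc.ne r p hrp
  simp only [h.bracket]
  field_simp at h1 ⊢
  linear_combination h1

/-- The gauge-fixed representative of a configuration, as a tuple of cross-ratios. -/
noncomputable def normalForm (p q r : ι) (c : ι → ℂ × ℂ) : Free p q r → ℂ := fun a =>
  bracket c a p * bracket c q r / (bracket c a r * bracket c q p)

theorem normalForm_puncture {p q r : ι} (hpq : p ≠ q) (hqr : q ≠ r) (hrp : r ≠ p)
    (z : Free p q r → ℂ) : normalForm p q r (puncture p q r z) = z := by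
  ext a
  simp [normalForm, bracket, puncture_free, puncture_snd hpq, puncture_thd hqr hrp]

theorem IsMoebius.normalForm {t : ι → ℂ} {c c' : ι → ℂ × ℂ} (h : IsMoebius t c c') (p q r : ι) :
    normalForm p q r c' = normalForm p q r c := by
  ext a
  simp only [CHY.normalForm, h.bracket]
  have h1 := h.1 p
  have h2 := h.1 q
  have h3 := h.1 r
  have h4 := h.1 a
  rw [show t a * t p * CHY.bracket c a p * (t q * t r * CHY.bracket c q r)
      = (t a * t p * t q * t r) * (CHY.bracket c a p * CHY.bracket c q r) by ring,
    show t a * t r * CHY.bracket c a r * (t q * t p * CHY.bracket c q p)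
      = (t a * t p * t q * t r) * (CHY.bracket c a r * CHY.bracket c q p) by ring,
    mul_div_mul_left _ _ (by simp [h1, h2, h3, h4])]

theorem exists_isMoebius_normalForm {p q r : ι} (hpq : p ≠ q) (hqr : q ≠ r) (hrp : r ≠ p)
    {c : ι → ℂ × ℂ} (hc : ∀ a b, a ≠ b → bracket c a b ≠ 0) :
    ∃ t, IsMoebius t c (puncture p q r (normalForm p q r c)) := by
  have hQ : bracket c q r ≠ 0 := hc q r hqr
  have hR : bracket c q p ≠ 0 := hc q p hpq.symm
  have hpr : bracket c p r ≠ 0 := hc p r hrp.symm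
  have hrp' : bracket c r p ≠ 0 := hc r p hrp
  obtain ⟨e, he⟩ := IsAlgClosed.exists_pow_nat_eq
    (bracket c q r * bracket c q p * bracket c p r) (n := 2) (by norm_num)
  have he0 : e ≠ 0 := by
    rintro rfl
    simp [hQ, hR, hpr] at he
  refine ⟨fun a => if a = r then e / (bracket c r p * bracket c q r)
    else e / (bracket c a r * bracket c q p), fun a => ?_,
    (c p).2 * bracket c q r / e, - (c p).1 * bracket c q r / e,
    (c r).2 * bracket c q p / e, - (c r).1 * bracket c q p / e, ?_, fun a => ?_⟩
  · dsimp only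
    split_ifs with har
    · simp [he0, hQ, hrp']
    · simp [he0, hR, hc a r har]
  · field_simp
    rw [he]
    simp only [bracket]
    ring
  · dsimp only
    have e1 : (c p).2 * bracket c q r / e * (c a).1 + -(c p).1 * bracket c q r / e * (c a).2
        = bracket c a p * bracket c q r / e := by
      simp only [bracket]
      ring
    have e2 : (c r).2 * bracket c q p / e * (c a).1 + -(c r).1 * bracket c q p / e * (c a).2
        = bracket c a r * bracket c q p / e := by
      simp only [bracket]
      ring
    rw [e1, e2]
    by_cases har : a = r
    · subst har
      rw [puncture_thd hqr hrp, if_pos rfl]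
      refine Prod.ext ?_ ?_
      · field_simp
      · simp
    · have := hc a r har
      rw [if_neg har]
      by_cases hap : a = p
      · subst hap
        rw [puncture_fst]
        refine Prod.ext ?_ ?_
        · simp
        · field_simp
      · by_cases haq : a = q
        · subst haq
          rw [puncture_snd hpq]
          refine Prod.ext ?_ ?_ <;> field_simp
        · rw [puncture_free _ ⟨a, hap, haq, har⟩]
          refine Prod.ext ?_ ?_
          · simp only [CHY.normalForm]
            field_simp
          · field_simp

/-- The CHY integral of a covariant integrand does not depend on the choice of fixed punctures. -/
theorem chyIntegral_gauge {s : Matrix ι ι ℂ} (hs : IsMandelstam s) {p q r p' q' r' : ι}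
    (hpq : p ≠ q) (hqr : q ≠ r) (hrp : r ≠ p) (hpq' : p' ≠ q') (hqr' : q' ≠ r') (hrp' : r' ≠ p')
    {F : (ι → ℂ × ℂ) → ℂ}
    (hF : ∀ t c c', IsCritical s c → IsMoebius t c c' → F c' * ∏ a, t a ^ 4 = F c) :
    chyIntegral s p q r F = chyIntegral s p' q' r' F := by
  have : Nontrivial ι := ⟨p, q, hpq⟩
  have maps : ∀ {p q r p' q' r' : ι}, p ≠ q → q ≠ r → r ≠ p → p' ≠ q' → q' ≠ r' → r' ≠ p' →
      ∀ z ∈ solutions s p q r,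
        normalForm p' q' r' (puncture p q r z) ∈ solutions s p' q' r' ∧
        normalForm p q r (puncture p' q' r' (normalForm p' q' r' (puncture p q r z))) = z := by
    intro p q r p' q' r' hpq hqr hrp hpq' hqr' hrp' z hz
    rw [mem_solutions_iff hs hpq hqr hrp] at hz
    obtain ⟨t, ht⟩ := exists_isMoebius_normalForm hpq' hqr' hrp' hz.ne
    rw [mem_solutions_iff hs hpq' hqr' hrp', ht.normalForm, normalForm_puncture hpq hqr hrp]
    exact ⟨ht.isCritical hz, rfl⟩
  unfold chyIntegral
  refine finsum_mem_eq_of_bijOn (fun z => normalForm p' q' r' (puncture p q r z))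
    (Set.InvOn.bijOn (f' := fun z => normalForm p q r (puncture p' q' r' z))
      ⟨fun z hz => (maps hpq hqr hrp hpq' hqr' hrp' z hz).2,
        fun z hz => (maps hpq' hqr' hrp' hpq hqr hrp z hz).2⟩
      (fun z hz => (maps hpq hqr hrp hpq' hqr' hrp' z hz).1)
      (fun z hz => (maps hpq' hqr' hrp' hpq hqr hrp z hz).1)) ?_
  intro z hz
  rw [mem_solutions_iff hs hpq hqr hrp] at hz
  obtain ⟨t, ht⟩ := exists_isMoebius_normalForm hpq' hqr' hrp' hz.ne
  have h1 := ht.det_hessian hz hpq hqr hrp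
  have h2 := det_hessian_gauge hs (ht.isCritical hz) hpq hqr hrp hpq' hqr' hrp'
  have h3 := hF t _ _ hz ht
  have h4 : ∏ a, t a ^ 4 ≠ 0 := Finset.prod_ne_zero_iff.2 fun a _ => pow_ne_zero 4 (ht.1 a)
  have reorder : ∀ x y d : ℂ, x * y / d = y * (d / x)⁻¹ := fun x y d => by
    rw [inv_div]
    ring
  simp only [hessian_eq_principal, reorder]
  rw [← h2, ← h1, ← h3, mul_inv]
  field_simp

theorem matrixA_mulVec_eq_zero {s : Matrix ι ι ℂ} {c : ι → ℂ × ℂ} (hc : IsCritical s c) (κ μ : ℂ) :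
    matrixA s c *ᵥ (fun b => κ * (c b).1 + μ * (c b).2) = 0 := by
  ext a
  have h1 := hc.fst a
  have h2 := hc.snd a
  have : (matrixA s c *ᵥ (fun b => κ * (c b).1 + μ * (c b).2)) a
      = κ * ∑ b, s a b * (c b).1 / bracket c a b + μ * ∑ b, s a b * (c b).2 / bracket c a b := by
    simp only [Finset.mul_sum, ← Finset.sum_add_distrib, Matrix.mulVec, dotProduct]
    refine Finset.sum_congr rfl fun b _ => ?_
    by_cases hab : a = b
    · subst hab
      simp [matrixA]
    · simp only [matrixA, if_neg hab]
      ring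
  rw [this, h1, h2]
  simp

theorem matrixA_transpose {s : Matrix ι ι ℂ} (hs : IsMandelstam s) (c : ι → ℂ × ℂ) :
    (matrixA s c)ᵀ = - matrixA s c := by
  ext a b
  rw [Matrix.transpose_apply, Matrix.neg_apply]
  by_cases hab : a = b
  · simp [matrixA, hab]
  · simp only [matrixA, if_neg hab, if_neg (Ne.symm hab), hs.symm b a, bracket_swap c a b]
    ring

theorem reducedDet_swap (s : Matrix ι ι ℂ) (u v : ι) (c : ι → ℂ × ℂ) :
    reducedDet s u v c = reducedDet s v u c := by
  unfold reducedDet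
  congr 1
  · exact det_eq_of_bijective _ _ (Equiv.subtypeEquivRight fun x => by tauto)
      (Equiv.bijective _) fun _ _ => rfl
  · rw [bracket_swap c v u, neg_sq]

theorem reducedDet_exchange {s : Matrix ι ι ℂ} (hs : IsMandelstam s) {c : ι → ℂ × ℂ}
    (hc : IsCritical s c) {u u' v : ι} (hu : u ≠ v) (hu' : u' ≠ v) :
    reducedDet s u v c = reducedDet s u' v c := by
  have h1 : matrixA s c *ᵥ (fun x => bracket c x v) = 0 := by
    convert matrixA_mulVec_eq_zero hc (c v).2 (- (c v).1) using 2
    ext x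
    simp only [bracket]
    ring
  have h2 := det_principal_exchange (matrixA s c) _ h1
    (by rw [matrixA_transpose hs, Matrix.neg_mulVec, h1, neg_zero]) (fun x => x ≠ v)
    (fun x => x ≠ u ∧ x ≠ v) (fun x => x ≠ u' ∧ x ≠ v)
    (fun x hx => by
      rw [not_not] at hx
      rw [hx, bracket_self]) u u' (fun x => and_comm) (fun x => and_comm)
  have n1 := hc.ne u v hu
  have n2 := hc.ne u' v hu'
  unfold reducedDet
  rw [div_eq_div_iff (by simp [n1]) (by simp [n2])]
  exact h2

/-- At a critical point the reduced determinant does not depend on the removed labels. -/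
theorem reducedDet_eq {s : Matrix ι ι ℂ} (hs : IsMandelstam s) {c : ι → ℂ × ℂ}
    (hc : IsCritical s c) {u v u' v' : ι} (huv : u ≠ v) (huv' : u' ≠ v') :
    reducedDet s u v c = reducedDet s u' v' c := by
  by_cases h : u' = v
  · subst h
    rw [reducedDet_swap s u' v', reducedDet_exchange hs hc huv huv'.symm]
  · rw [reducedDet_exchange hs hc huv h, reducedDet_swap s u' v, reducedDet_swap s u' v',
      reducedDet_exchange hs hc (Ne.symm h) huv'.symm]

theorem IsMoebius.matrixA {s : Matrix ι ι ℂ} {t : ι → ℂ} {c c' : ι → ℂ × ℂ}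
    (h : IsMoebius t c c') (a b : ι) :
    matrixA s c' a b = (t a)⁻¹ * matrixA s c a b * (t b)⁻¹ := by
  by_cases hab : a = b
  · simp [CHY.matrixA, hab]
  · simp only [CHY.matrixA, if_neg hab, h.bracket]
    rw [div_eq_mul_inv, mul_inv, mul_inv]
    ring

theorem IsMoebius.reducedDet {s : Matrix ι ι ℂ} {t : ι → ℂ} {c c' : ι → ℂ × ℂ}
    (h : IsMoebius t c c') {u v : ι} (huv : u ≠ v) :
    reducedDet s u v c' * ∏ a, t a ^ 2 = reducedDet s u v c := by
  have h1 := det_principal_scale _ _ (fun a => (t a)⁻¹) (h.matrixA (s := s))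
    (fun a => a ≠ u ∧ a ≠ v)
  rw [prod_not_ne_and_ne (fun a => ((t a)⁻¹) ^ 2) huv] at h1
  simp only [inv_pow, Finset.prod_inv_distrib] at h1
  have h3 : ∏ a, t a ^ 2 ≠ 0 := Finset.prod_ne_zero_iff.2 fun a _ => pow_ne_zero 2 (h.1 a)
  have tu := h.1 u
  have tv := h.1 v
  unfold CHY.reducedDet
  rw [h.bracket, show ∀ x y z d : ℂ, x / (y * z * d) ^ 2 = x * ((y ^ 2)⁻¹ * (z ^ 2)⁻¹) / d ^ 2 by
    intro x y z d; rw [div_eq_mul_inv, mul_pow, mul_pow, mul_inv, mul_inv]; ring, h1]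
  field_simp

theorem IsMoebius.parkeTaylorCanonical {m : ℕ} [NeZero m] {t : ZMod m → ℂ}
    {c c' : ZMod m → ℂ × ℂ} (h : IsMoebius t c c') :
    parkeTaylorCanonical c' * ∏ a, t a ^ 2 = parkeTaylorCanonical c := by
  have h1 : ∏ a, t (a + 1) = ∏ a, t a :=
    Equiv.prod_comp (Equiv.addRight (1 : ZMod m)) t
  have h2 : ∏ a, t a ^ 2 = ∏ a, t a * t (a + 1) := by
    rw [Finset.prod_mul_distrib, h1, Finset.prod_pow, sq]
  unfold CHY.parkeTaylorCanonical
  rw [h2, ← Finset.prod_mul_distrib]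
  refine Finset.prod_congr rfl fun a _ => ?_
  have := h.1 a
  have := h.1 (a + 1)
  rw [h.bracket, mul_inv, mul_inv]
  field_simp

theorem IsMoebius.mixed {m : ℕ} [NeZero m] {s : Matrix (ZMod m) (ZMod m) ℂ} {t : ZMod m → ℂ}
    {c c' : ZMod m → ℂ × ℂ} (h : IsMoebius t c c') {p q r : ZMod m} (hpq : p ≠ q) (hqr : q ≠ r)
    (hrp : r ≠ p) :
    parkeTaylor [p, q, r] c' * (principal (CHY.matrixA s c') (fun a => a ∉ [p, q, r])).det
        * ∏ a, t a ^ 2 =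
      parkeTaylor [p, q, r] c * (principal (CHY.matrixA s c) (fun a => a ∉ [p, q, r])).det := by
  have h1 := det_principal_scale _ _ (fun a => (t a)⁻¹) (h.matrixA (s := s))
    (fun a => a ∉ [p, q, r])
  have h0 : ∏ a : {a // ¬ a ∉ [p, q, r]}, ((t a)⁻¹) ^ 2
      = (t p)⁻¹ ^ 2 * (t q)⁻¹ ^ 2 * (t r)⁻¹ ^ 2 := by
    rw [← Finset.prod_subtype {p, q, r} (fun x => by simp; tauto) (fun a => (t a)⁻¹ ^ 2),
      Finset.prod_insert (by simp [hpq, hrp.symm]), Finset.prod_pair hqr, mul_assoc]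
  rw [h0] at h1
  simp only [inv_pow, Finset.prod_inv_distrib] at h1
  have h3 : ∏ a, t a ^ 2 ≠ 0 := Finset.prod_ne_zero_iff.2 fun a _ => pow_ne_zero 2 (h.1 a)
  have tp := h.1 p
  have tq := h.1 q
  have tr := h.1 r
  have h4 : parkeTaylor [p, q, r] c' =
      parkeTaylor [p, q, r] c * ((t p ^ 2)⁻¹ * (t q ^ 2)⁻¹ * (t r ^ 2)⁻¹) := by
    simp only [parkeTaylor, List.rotate_cons_succ, List.rotate_zero, List.cons_append,
      List.nil_append, List.zipWith_cons_cons, List.zipWith_nil_left, List.prod_cons,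
      List.prod_nil, h.bracket, mul_inv]
    ring
  rw [h4, show ∀ x y z d : ℂ, x * y * z * d = x * (z * y) * d by intros; ring, h1]
  field_simp

/-- The integrand of the NLSM amplitude. -/
noncomputable def nlsmIntegrand {m : ℕ} [NeZero m] (s : Matrix (ZMod m) (ZMod m) ℂ)
    (u v : ZMod m) (c : ZMod m → ℂ × ℂ) : ℂ :=
  parkeTaylorCanonical c * reducedDet s u v c

/-- The integrand of the mixed amplitude. -/
noncomputable def mixedIntegrand {m : ℕ} [NeZero m] (s : Matrix (ZMod m) (ZMod m) ℂ)
    (β : List (ZMod m)) (c : ZMod m → ℂ × ℂ) : ℂ :=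
  parkeTaylorCanonical c * parkeTaylor β c * (principal (matrixA s c) (fun a => a ∉ β)).det

theorem chyIntegral_nlsmIntegrand_gauge {m : ℕ} [NeZero m] {s : Matrix (ZMod m) (ZMod m) ℂ}
    (hs : IsMandelstam s) {p q r p' q' r' u v : ZMod m} (hpq : p ≠ q) (hqr : q ≠ r) (hrp : r ≠ p)
    (hpq' : p' ≠ q') (hqr' : q' ≠ r') (hrp' : r' ≠ p') (huv : u ≠ v) :
    chyIntegral s p q r (nlsmIntegrand s u v) = chyIntegral s p' q' r' (nlsmIntegrand s u v) := by
  refine chyIntegral_gauge hs hpq hqr hrp hpq' hqr' hrp' fun t c c' hc h => ?_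
  have h4 : ∏ a, t a ^ 4 = (∏ a, t a ^ 2) * ∏ a, t a ^ 2 := by
    rw [← Finset.prod_mul_distrib]
    exact Finset.prod_congr rfl fun a _ => by ring
  simp only [nlsmIntegrand]
  rw [h4, ← h.parkeTaylorCanonical, ← h.reducedDet huv]
  ring

theorem chyIntegral_mixedIntegrand_gauge {m : ℕ} [NeZero m] {s : Matrix (ZMod m) (ZMod m) ℂ}
    (hs : IsMandelstam s) {p q r p' q' r' x y w : ZMod m} (hpq : p ≠ q) (hqr : q ≠ r)
    (hrp : r ≠ p) (hpq' : p' ≠ q') (hqr' : q' ≠ r') (hrp' : r' ≠ p') (hxy : x ≠ y) (hyw : y ≠ w)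
    (hwx : w ≠ x) :
    chyIntegral s p q r (mixedIntegrand s [x, y, w])
      = chyIntegral s p' q' r' (mixedIntegrand s [x, y, w]) := by
  refine chyIntegral_gauge hs hpq hqr hrp hpq' hqr' hrp' fun t c c' hc h => ?_
  have h4 : ∏ a, t a ^ 4 = (∏ a, t a ^ 2) * ∏ a, t a ^ 2 := by
    rw [← Finset.prod_mul_distrib]
    exact Finset.prod_congr rfl fun a _ => by ring
  simp only [mixedIntegrand]
  rw [h4, mul_assoc (parkeTaylorCanonical c), ← h.mixed (s := s) hxy hyw hwx,
    ← h.parkeTaylorCanonical]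
  ring

end GaugeIndependence

section Gluing

theorem det_blockDiagonal'_eq_prod {I : Type*} [Fintype I] [DecidableEq I] {m : I → Type*}
    [∀ i, Fintype (m i)] [∀ i, DecidableEq (m i)] (M : ∀ i, Matrix (m i) (m i) ℂ) :
    (Matrix.blockDiagonal' M).det = ∏ i, (M i).det := by
  let e := Fintype.equivFin I
  have h : (Matrix.blockDiagonal' M).BlockTriangular fun x => e x.1 := by
    rintro ⟨i, t⟩ ⟨i', t'⟩ hlt
    exact Matrix.blockDiagonal'_apply_ne _ _ _ (fun h => by simp [h] at hlt)
  rw [h.det_fintype, ← Equiv.prod_comp e]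
  refine Finset.prod_congr rfl fun i _ => ?_
  refine det_eq_of_bijective _ _
    (fun t : m i => (⟨⟨i, t⟩, rfl⟩ : {x : Σ i, m i // e x.1 = e i})) ⟨?_, ?_⟩ fun t t' => ?_
  · intro t t' h
    simpa using h
  · rintro ⟨⟨i', t⟩, h⟩
    obtain rfl := e.injective h
    exact ⟨t, rfl⟩
  · exact (Matrix.blockDiagonal'_apply_eq M i t t').symm

theorem finsum_pi_prod {I : Type*} [Fintype I] [DecidableEq I] {X : I → Type*}
    (f : ∀ i, X i → ℂ) : ∑ᶠ w : ∀ i, X i, ∏ i, f i (w i) = ∏ i, ∑ᶠ x, f i x := by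
  classical
  by_cases h : ∀ i, (Function.support (f i)).Finite
  · have h1 : ∀ i, ∑ᶠ x, f i x = ∑ x ∈ (h i).toFinset, f i x := fun i =>
      finsum_eq_sum_of_support_subset _ (by simp)
    simp only [h1]
    rw [Finset.prod_univ_sum]
    apply finsum_eq_sum_of_support_subset
    intro w hw
    rw [Function.mem_support, Finset.prod_ne_zero_iff] at hw
    simpa using hw
  · push Not at h
    obtain ⟨i, hi⟩ := h
    rw [Finset.prod_eq_zero (Finset.mem_univ i) (finsum_of_infinite_support hi)]
    by_cases hne : ∀ i, ∃ x, f i x ≠ 0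
    · choose w₀ hw₀ using hne
      apply finsum_of_infinite_support
      refine Set.infinite_of_injOn_mapsTo (f := fun x => Function.update w₀ i x)
        ((Function.update_injective w₀ i).injOn) ?_ hi
      intro x hx
      rw [Function.mem_support, Finset.prod_ne_zero_iff]
      intro i' _
      by_cases hii : i' = i
      · subst hii
        simpa using hx
      · simpa [hii] using hw₀ i'
    · push Not at hne
      obtain ⟨i', hi'⟩ := hne
      rw [← finsum_zero (α := ∀ i, X i)]
      exact finsum_congr fun w => Finset.prod_eq_zero (Finset.mem_univ i') (hi' _)

theorem finsum_mem_pi_prod {I : Type*} [Fintype I] [DecidableEq I] {X : I → Type*}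
    (S : ∀ i, Set (X i)) (f : ∀ i, X i → ℂ) :
    ∑ᶠ w ∈ Set.univ.pi S, ∏ i, f i (w i) = ∏ i, ∑ᶠ x ∈ S i, f i x := by
  simp only [finsum_mem_def]
  rw [← finsum_pi_prod]
  refine finsum_congr fun w => ?_
  by_cases hw : w ∈ Set.univ.pi S
  · rw [Set.indicator_of_mem hw]
    exact Finset.prod_congr rfl fun i _ => (Set.indicator_of_mem (hw i trivial) _).symm
  · rw [Set.indicator_of_notMem hw]
    simp only [Set.mem_pi, Set.mem_univ, true_implies, not_forall] at hw
    obtain ⟨i, hi⟩ := hw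
    exact (Finset.prod_eq_zero (Finset.mem_univ i) (Set.indicator_of_notMem hi _)).symm

variable {I : Type*} [Fintype I] [DecidableEq I] {ι : Type*} [Fintype ι] [DecidableEq ι]
  {κ : I → Type*} [∀ i, Fintype (κ i)] [∀ i, DecidableEq (κ i)]

/-- The labels `ι` are obtained by gluing the sets of labels `κ i` along the three labels `p`, `q`,
`r`, and the invariants `s` couple no labels of different pieces other than these three. -/
structure IsGluing (s : Matrix ι ι ℂ) (S : ∀ i, Matrix (κ i) (κ i) ℂ) (φ : ∀ i, κ i → ι)
    (p q r : ι) (P Q R : ∀ i, κ i) : Prop where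
  mandelstam : IsMandelstam s
  mandelstam_piece : ∀ i, IsMandelstam (S i)
  ne_pq : p ≠ q
  ne_qr : q ≠ r
  ne_rp : r ≠ p
  injective : ∀ i, Function.Injective (φ i)
  map_p : ∀ i, φ i (P i) = p
  map_q : ∀ i, φ i (Q i) = q
  map_r : ∀ i, φ i (R i) = r
  exists_preimage : ∀ a : Free p q r, ∃ i t, φ i t = a
  ne_of_ne : ∀ i i' (t : Free (P i) (Q i) (R i)) (t' : Free (P i') (Q i') (R i')), i ≠ i' →
    φ i t ≠ φ i' t'
  eq_zero_of_ne : ∀ i i' (t : Free (P i) (Q i) (R i)) (t' : Free (P i') (Q i') (R i')), i ≠ i' →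
    s (φ i t) (φ i' t') = 0
  agree : ∀ i (t : Free (P i) (Q i) (R i)) (u : κ i), S i t u = s (φ i t) (φ i u)

namespace IsGluing

variable {s : Matrix ι ι ℂ} {S : ∀ i, Matrix (κ i) (κ i) ℂ} {φ : ∀ i, κ i → ι}
  {p q r : ι} {P Q R : ∀ i, κ i}

theorem ne_PQ (g : IsGluing s S φ p q r P Q R) (i : I) : P i ≠ Q i := fun h =>
  g.ne_pq (by rw [← g.map_p i, h, g.map_q i])

theorem ne_QR (g : IsGluing s S φ p q r P Q R) (i : I) : Q i ≠ R i := fun h =>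
  g.ne_qr (by rw [← g.map_q i, h, g.map_r i])

theorem ne_RP (g : IsGluing s S φ p q r P Q R) (i : I) : R i ≠ P i := fun h =>
  g.ne_rp (by rw [← g.map_r i, h, g.map_p i])

theorem ne_of_free (g : IsGluing s S φ p q r P Q R) {i : I} (t : Free (P i) (Q i) (R i)) :
    φ i t ≠ p ∧ φ i t ≠ q ∧ φ i t ≠ r := by
  rw [← g.map_p i, ← g.map_q i, ← g.map_r i, (g.injective i).ne_iff, (g.injective i).ne_iff,
    (g.injective i).ne_iff]
  exact t.2

/-- The free labels of the pieces, as free labels of the whole. -/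
def freeMap (g : IsGluing s S φ p q r P Q R) (x : Σ i, Free (P i) (Q i) (R i)) : Free p q r :=
  ⟨φ x.1 x.2, g.ne_of_free x.2⟩

theorem exists_free (g : IsGluing s S φ p q r P Q R) (a : Free p q r) :
    ∃ (i : I) (t : Free (P i) (Q i) (R i)), φ i t = a := by
  obtain ⟨i, t, ht⟩ := g.exists_preimage a
  refine ⟨i, ⟨t, ?_, ?_, ?_⟩, ht⟩
  · rintro rfl
    exact a.2.1 (by rw [← ht, g.map_p])
  · rintro rfl
    exact a.2.2.1 (by rw [← ht, g.map_q])
  · rintro rfl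
    exact a.2.2.2 (by rw [← ht, g.map_r])

theorem freeMap_bijective (g : IsGluing s S φ p q r P Q R) : Function.Bijective g.freeMap := by
  constructor
  · rintro ⟨i, t⟩ ⟨i', t'⟩ h
    have h' : φ i t = φ i' t' := congrArg Subtype.val h
    by_cases hi : i = i'
    · subst hi
      rw [Subtype.ext (g.injective i h')]
    · exact absurd h' (g.ne_of_ne i i' t t' hi)
  · intro a
    obtain ⟨i, t, ht⟩ := g.exists_free a
    exact ⟨⟨i, t⟩, Subtype.ext ht⟩

/-- The free labels of the whole are those of the pieces. -/
noncomputable def freeEquiv (g : IsGluing s S φ p q r P Q R) :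
    (Σ i, Free (P i) (Q i) (R i)) ≃ Free p q r :=
  Equiv.ofBijective g.freeMap g.freeMap_bijective

/-- A configuration of punctures amounts to one for each of the pieces. -/
noncomputable def configEquiv (g : IsGluing s S φ p q r P Q R) :
    (Free p q r → ℂ) ≃ ∀ i, Free (P i) (Q i) (R i) → ℂ :=
  (Equiv.arrowCongr g.freeEquiv.symm (Equiv.refl ℂ)).trans (Equiv.piCurry fun _ _ => ℂ)

theorem puncture_configEquiv (g : IsGluing s S φ p q r P Q R) (z : Free p q r → ℂ) (i : I) :
    puncture (P i) (Q i) (R i) (g.configEquiv z i) = puncture p q r z ∘ φ i := by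
  ext1 t
  rw [Function.comp_apply]
  by_cases h1 : t = P i
  · subst h1
    rw [g.map_p, puncture_fst, puncture_fst]
  by_cases h2 : t = Q i
  · subst h2
    rw [g.map_q, puncture_snd (g.ne_PQ i), puncture_snd g.ne_pq]
  by_cases h3 : t = R i
  · subst h3
    rw [g.map_r, puncture_thd (g.ne_QR i) (g.ne_RP i), puncture_thd g.ne_qr g.ne_rp]
  let t' : Free (P i) (Q i) (R i) := ⟨t, h1, h2, h3⟩
  exact (puncture_free _ t').trans (puncture_free z ⟨φ i t, g.ne_of_free t'⟩).symm

theorem eq_zero_of_notMem_range (g : IsGluing s S φ p q r P Q R) {i : I}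
    (t : Free (P i) (Q i) (R i)) {b : ι} (hb : b ∉ Set.range (φ i)) : s (φ i t) b = 0 := by
  have h1 : b ≠ p := fun h => hb ⟨P i, by rw [g.map_p, h]⟩
  have h2 : b ≠ q := fun h => hb ⟨Q i, by rw [g.map_q, h]⟩
  have h3 : b ≠ r := fun h => hb ⟨R i, by rw [g.map_r, h]⟩
  obtain ⟨i', t', ht'⟩ := g.exists_free ⟨b, h1, h2, h3⟩
  have hi : i ≠ i' := by
    rintro rfl
    exact hb ⟨_, ht'⟩
  have := g.eq_zero_of_ne i i' t t' hi
  rwa [ht'] at this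

theorem sum_eq_sum_piece (g : IsGluing s S φ p q r P Q R) {i : I} (t : Free (P i) (Q i) (R i))
    (f : ι → ℂ) (hf : ∀ b, s (φ i t) b = 0 → f b = 0) : ∑ b, f b = ∑ u, f (φ i u) :=
  (Fintype.sum_of_injective (φ i) (g.injective i) _ _
    (fun b hb => hf b (g.eq_zero_of_notMem_range t hb)) fun _ => rfl).symm

theorem gradient_eq (g : IsGluing s S φ p q r P Q R) (c : ι → ℂ × ℂ) {i : I}
    (t : Free (P i) (Q i) (R i)) : gradient s c (φ i t) = gradient (S i) (c ∘ φ i) t := by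
  rw [gradient_eq_sum, gradient_eq_sum, g.sum_eq_sum_piece t _ fun b hb => by simp [hb]]
  refine Finset.sum_congr rfl fun u _ => ?_
  rw [g.agree]
  rfl

theorem mem_solutions_piece (g : IsGluing s S φ p q r P Q R) {z : Free p q r → ℂ}
    (hz : z ∈ solutions s p q r) (i : I) :
    g.configEquiv z i ∈ solutions (S i) (P i) (Q i) (R i) := by
  refine ⟨fun t u htu => ?_, fun t => ?_⟩
  · rw [puncture_configEquiv]
    exact hz.1 _ _ ((g.injective i).ne htu)
  · rw [puncture_configEquiv, ← g.gradient_eq]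
    exact hz.2 ⟨φ i t, g.ne_of_free t⟩

theorem gradient_eq_zero (g : IsGluing s S φ p q r P Q R) {z : Free p q r → ℂ}
    (hz : ∀ i, g.configEquiv z i ∈ solutions (S i) (P i) (Q i) (R i)) (a : Free p q r) :
    gradient s (puncture p q r z) a = 0 := by
  obtain ⟨i, t, ht⟩ := g.exists_free a
  have := (hz i).2 t
  rwa [puncture_configEquiv, ← g.gradient_eq, ht] at this

theorem det_hessian (g : IsGluing s S φ p q r P Q R) (z : Free p q r → ℂ) :
    (hessian s p q r z).det
      = ∏ i, (hessian (S i) (P i) (Q i) (R i) (g.configEquiv z i)).det := by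
  rw [← det_blockDiagonal'_eq_prod]
  refine det_eq_of_bijective _ _ g.freeMap g.freeMap_bijective ?_
  rintro ⟨i, t⟩ ⟨i', t'⟩
  by_cases hi : i = i'
  · subst hi
    rw [Matrix.blockDiagonal'_apply_eq, hessian_eq_principal, hessian_eq_principal]
    simp only [principal, Matrix.submatrix_apply, freeMap, puncture_configEquiv]
    by_cases htt : t = t'
    · subst htt
      simp only [homogeneousHessian, if_true]
      have h1 : (puncture p q r z (φ i t)).2 = 1 :=
        congrArg Prod.snd (puncture_free z ⟨φ i t, g.ne_of_free t⟩)
      simp only [Function.comp_apply, h1, one_ne_zero, if_false]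
      rw [g.sum_eq_sum_piece t _ fun b hb => by simp [hb]]
      simp only [g.agree]
      rfl
    · have h1 : (t : κ i) ≠ t' := fun h => htt (Subtype.ext h)
      simp only [homogeneousHessian, if_neg h1, if_neg ((g.injective i).ne h1), g.agree]
      rfl
  · rw [Matrix.blockDiagonal'_apply_ne _ _ _ hi]
    have h1 : g.freeMap ⟨i, t⟩ ≠ g.freeMap ⟨i', t'⟩ := fun h =>
      g.ne_of_ne i i' t t' hi (congrArg Subtype.val h)
    simp only [hessian, if_neg h1]
    simp [freeMap, g.eq_zero_of_ne i i' t t' hi]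

/-- Factorisation of a CHY integral into the CHY integrals of the pieces. -/
theorem chyIntegral_eq_prod (g : IsGluing s S φ p q r P Q R)
    (hcoll : ∀ z : Free p q r → ℂ,
      (∀ i, g.configEquiv z i ∈ solutions (S i) (P i) (Q i) (R i)) →
      ∀ a b, a ≠ b → bracket (puncture p q r z) a b ≠ 0)
    (F : (ι → ℂ × ℂ) → ℂ) (G : ∀ i, (κ i → ℂ × ℂ) → ℂ)
    (hFG : ∀ z ∈ solutions s p q r,
      F (puncture p q r z) = ∏ i, G i (puncture p q r z ∘ φ i)) :
    chyIntegral s p q r F = ∏ i, chyIntegral (S i) (P i) (Q i) (R i) (G i) := by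
  unfold chyIntegral
  rw [← finsum_mem_pi_prod]
  refine finsum_mem_eq_of_bijOn g.configEquiv
    ⟨fun z hz i _ => g.mem_solutions_piece hz i, g.configEquiv.injective.injOn, fun w hw => ?_⟩ ?_
  · refine ⟨g.configEquiv.symm w, ?_, g.configEquiv.apply_symm_apply w⟩
    have h : ∀ i, g.configEquiv (g.configEquiv.symm w) i
        ∈ solutions (S i) (P i) (Q i) (R i) := fun i => by
      rw [g.configEquiv.apply_symm_apply]
      exact hw i trivial
    exact ⟨hcoll _ h, g.gradient_eq_zero h⟩
  · intro z hz
    obtain ⟨h1, h2, h3⟩ := bracket_gauge g.ne_pq g.ne_qr g.ne_rp z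
    have h4 := fun i => bracket_gauge (g.ne_PQ i) (g.ne_QR i) (g.ne_RP i) (g.configEquiv z i)
    simp only [h1, h2, h3, (h4 _).1, (h4 _).2.1, (h4 _).2.2]
    rw [hFG z hz, g.det_hessian, Finset.prod_div_distrib]
    simp [puncture_configEquiv]

theorem matrixA_eq (g : IsGluing s S φ p q r P Q R) (c : ι → ℂ × ℂ) {i : I}
    (t : Free (P i) (Q i) (R i)) (u : κ i) :
    matrixA (S i) (c ∘ φ i) t u = matrixA s c (φ i t) (φ i u) := by
  by_cases h : t = u
  · simp [matrixA, h]
  · simp only [matrixA, if_neg h, if_neg ((g.injective i).ne h), g.agree]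
    rfl

theorem matrixA_eq' (g : IsGluing s S φ p q r P Q R) (c : ι → ℂ × ℂ) {i : I}
    (t : κ i) (u : Free (P i) (Q i) (R i)) :
    matrixA (S i) (c ∘ φ i) t u = matrixA s c (φ i t) (φ i u) := by
  have h1 := congrFun (congrFun (matrixA_transpose (g.mandelstam_piece i) (c ∘ φ i)) u) t
  have h2 := congrFun (congrFun (matrixA_transpose g.mandelstam c) (φ i u)) (φ i t)
  simp only [Matrix.transpose_apply, Matrix.neg_apply] at h1 h2
  rw [h1, h2, g.matrixA_eq]

/-- If all pieces but one have an even number of free labels, the minor of `A` in which two of the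
three common labels are removed factorises. -/
theorem det_matrixA (g : IsGluing s S φ p q r P Q R) (c : ι → ℂ × ℂ) (i₀ : I) (u v x : κ i₀)
    (huvx : ∀ t, (t ≠ P i₀ ∧ t ≠ Q i₀ ∧ t ≠ R i₀) ↔ (t ≠ u ∧ t ≠ v ∧ t ≠ x)) (hxu : x ≠ u)
    (hxv : x ≠ v)
    (hev : Even (∑ i : {i // i ≠ i₀},
      Fintype.card (Free (P i.1) (Q i.1) (R i.1)))) :
    (principal (matrixA s c) (fun a => a ≠ φ i₀ u ∧ a ≠ φ i₀ v)).det =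
      (principal (matrixA (S i₀) (c ∘ φ i₀)) (fun t => t ≠ u ∧ t ≠ v)).det *
        ∏ i : {i // i ≠ i₀}, (principal (matrixA (S i.1) (c ∘ φ i.1))
          (fun t => t ≠ P i.1 ∧ t ≠ Q i.1 ∧ t ≠ R i.1)).det := by
  classical
  have hspecial : ∀ t, ¬ (t ≠ P i₀ ∧ t ≠ Q i₀ ∧ t ≠ R i₀) → ¬ (φ i₀ t ≠ p ∧ φ i₀ t ≠ q ∧
      φ i₀ t ≠ r) := by
    intro t
    rw [← g.map_p i₀, ← g.map_q i₀, ← g.map_r i₀, (g.injective i₀).ne_iff,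
      (g.injective i₀).ne_iff, (g.injective i₀).ne_iff]
    exact id
  have hu := hspecial u fun h => ((huvx u).1 h).1 rfl
  have hv := hspecial v fun h => ((huvx v).1 h).2.1 rfl
  let pr : {a // a ≠ φ i₀ u ∧ a ≠ φ i₀ v} → Prop := fun a => (a : ι) ∈ Set.range (φ i₀)
  let f : (Σ i : {i // i ≠ i₀}, Free (P i.1) (Q i.1) (R i.1)) → {a // ¬ pr a} := fun y =>
    ⟨⟨φ y.1 y.2, fun h => hu (h ▸ g.ne_of_free y.2), fun h => hv (h ▸ g.ne_of_free y.2)⟩, by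
      rintro ⟨t, ht⟩
      change φ i₀ t = φ y.1 y.2 at ht
      have h1 : t ≠ P i₀ ∧ t ≠ Q i₀ ∧ t ≠ R i₀ := by
        by_contra h
        exact hspecial t h (ht ▸ g.ne_of_free y.2)
      exact g.ne_of_ne i₀ y.1 ⟨t, h1⟩ y.2 (Ne.symm y.1.2) ht⟩
  have hf : Function.Bijective f := by
    constructor
    · rintro ⟨⟨i, hi⟩, t⟩ ⟨⟨i', hi'⟩, t'⟩ h
      have h' : φ i t = φ i' t' := congrArg (fun a => (a.1.1 : ι)) h
      by_cases hii : i = i'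
      · subst hii
        rw [Subtype.ext (g.injective i h')]
      · exact absurd h' (g.ne_of_ne i i' t t' hii)
    · rintro ⟨⟨a, hau, hav⟩, hpr⟩
      have h1 : a ≠ p := fun h => hpr ⟨P i₀, (g.map_p i₀).trans h.symm⟩
      have h2 : a ≠ q := fun h => hpr ⟨Q i₀, (g.map_q i₀).trans h.symm⟩
      have h3 : a ≠ r := fun h => hpr ⟨R i₀, (g.map_r i₀).trans h.symm⟩
      obtain ⟨i, t, ht⟩ := g.exists_free ⟨a, h1, h2, h3⟩
      refine ⟨⟨⟨i, ?_⟩, t⟩, Subtype.ext (Subtype.ext ht)⟩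
      rintro rfl
      exact hpr ⟨t, ht⟩
  rw [det_of_skew_star _ _ pr ⟨φ i₀ x, (g.injective i₀).ne hxu, (g.injective i₀).ne hxv⟩
    ⟨x, rfl⟩]
  · congr 1
    · refine det_eq_of_bijective _ _
        (fun t : {t // t ≠ u ∧ t ≠ v} => (⟨⟨φ i₀ t, (g.injective i₀).ne t.2.1,
          (g.injective i₀).ne t.2.2⟩, t, rfl⟩ : {a // pr a})) ⟨?_, ?_⟩ ?_
      · intro t t' h
        exact Subtype.ext (g.injective i₀ (congrArg (fun a => (a.1.1 : ι)) h))
      · rintro ⟨⟨a, hau, hav⟩, t, ht⟩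
        change φ i₀ t = a at ht
        subst ht
        exact ⟨⟨t, fun h => hau (h ▸ rfl), fun h => hav (h ▸ rfl)⟩, rfl⟩
      · intro t t'
        change matrixA (S i₀) (c ∘ φ i₀) t t' = matrixA s c (φ i₀ t) (φ i₀ t')
        by_cases h1 : (t : κ i₀) = x
        · by_cases h2 : (t' : κ i₀) = x
          · simp [matrixA, h1, h2]
          · exact g.matrixA_eq' (i := i₀) c t ⟨t', (huvx t').2 ⟨t'.2.1, t'.2.2, h2⟩⟩
        · exact g.matrixA_eq (i := i₀) c ⟨t, (huvx t).2 ⟨t.2.1, t.2.2, h1⟩⟩ t'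
    · rw [← det_blockDiagonal'_eq_prod]
      refine det_eq_of_bijective _ _ f hf ?_
      rintro ⟨i, t⟩ ⟨i', t'⟩
      by_cases hii : i = i'
      · subst hii
        rw [Matrix.blockDiagonal'_apply_eq]
        exact g.matrixA_eq c t t'
      · rw [Matrix.blockDiagonal'_apply_ne _ _ _ hii]
        have h0 := g.eq_zero_of_ne i i' t t' fun h => hii (Subtype.ext h)
        change 0 = matrixA s c (φ i t) (φ i' t')
        simp [matrixA, h0]
  · rintro ⟨a, hau, hav⟩ b ⟨t, ht⟩ hax hb
    change φ i₀ t = a at ht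
    subst ht
    have h1 : t ≠ x := fun h => hax (by simp [h])
    have h2 := g.eq_zero_of_notMem_range (i := i₀) ⟨t, (huvx t).2
      ⟨fun h => hau (h ▸ rfl), fun h => hav (h ▸ rfl), h1⟩⟩ hb
    change matrixA s c (φ i₀ t) b = 0
    simp [matrixA, h2]
  · rw [← Fintype.card_of_bijective hf, Fintype.card_sigma]
    exact hev
  · ext a b
    exact congrFun (congrFun (matrixA_transpose g.mandelstam c) a) b

end IsGluing

end Gluing

section Arcs

@[to_additive]
theorem prod_zmod {m : ℕ} [NeZero m] {M : Type*} [CommMonoid M] (f : ZMod m → M) :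
    ∏ t, f t = ∏ x ∈ Finset.range m, f (x : ZMod m) :=
  Finset.prod_nbij' (fun t => t.val) (fun x => (x : ZMod m))
    (fun t _ => Finset.mem_range.2 t.val_lt) (fun _ _ => Finset.mem_univ _)
    (fun t _ => t.natCast_zmod_val)
    (fun x hx => ZMod.val_cast_of_lt (Finset.mem_range.1 hx))
    (fun t _ => by rw [t.natCast_zmod_val])

theorem natCast_zmod_inj {n x y : ℕ} (hx : 1 ≤ x) (hxn : x ≤ n) (hy : 1 ≤ y) (hyn : y ≤ n)
    (h : (x : ZMod n) = y) : x = y := by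
  obtain ⟨x, rfl⟩ := Nat.exists_eq_add_of_le hx
  obtain ⟨y, rfl⟩ := Nat.exists_eq_add_of_le hy
  rw [ZMod.natCast_eq_natCast_iff] at h
  have h' := Nat.ModEq.add_left_cancel' 1 h
  rw [Nat.ModEq, Nat.mod_eq_of_lt (by omega), Nat.mod_eq_of_lt (by omega)] at h'
  rw [h']

theorem exists_natCast_eq {n : ℕ} [NeZero n] (a : ZMod n) : ∃ x : ℕ, 1 ≤ x ∧ x ≤ n ∧ a = x := by
  by_cases h : a = 0
  · exact ⟨n, NeZero.one_le, le_rfl, by simp [h]⟩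
  · exact ⟨a.val, Nat.one_le_iff_ne_zero.2 ((ZMod.val_ne_zero a).2 h), a.val_lt.le,
      a.natCast_zmod_val.symm⟩

variable {l : ℕ}

theorem val_one_leg : (1 : ZMod (l + 3)).val = 1 := by
  rw [ZMod.val_one_eq_one_mod, Nat.mod_eq_of_lt (by omega)]

theorem val_neg_one_leg : (-1 : ZMod (l + 3)).val = l + 2 := ZMod.val_neg_one (l + 2)

theorem one_ne_neg_one_leg : (1 : ZMod (l + 3)) ≠ -1 := fun h => by
  have := congrArg ZMod.val h
  rw [val_one_leg, val_neg_one_leg] at this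
  omega

theorem neg_one_ne_zero_leg : (-1 : ZMod (l + 3)) ≠ 0 := fun h => by
  have := congrArg ZMod.val h
  rw [ZMod.val_zero, val_neg_one_leg] at this
  omega

theorem zero_ne_one_leg : (0 : ZMod (l + 3)) ≠ 1 := fun h => by
  have := congrArg ZMod.val h
  rw [ZMod.val_zero, val_one_leg] at this
  omega

theorem val_natCast_leg {x : ℕ} (hx : x < l + 2) : ((x + 1 : ℕ) : ZMod (l + 3)).val = x + 1 :=
  ZMod.val_cast_of_lt (by omega)

theorem natCast_leg_ne_zero {x : ℕ} (hx : x < l + 2) : ((x + 1 : ℕ) : ZMod (l + 3)) ≠ 0 := by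
  rw [← ZMod.val_ne_zero, val_natCast_leg hx]
  omega

variable {n : ℕ} [NeZero n]

/-- The particle associated with a leg of the current with on-shell legs `a, …, a + l + 1`, the
off-shell leg being represented by the particle `o`. -/
def arcMap (a l o : ℕ) (t : ZMod (l + 3)) : ZMod n :=
  if t = 0 then o else ((a + (t.val - 1) : ℕ) : ZMod n)

theorem arcMap_zero (a o : ℕ) : arcMap a l o 0 = (o : ZMod n) := if_pos rfl

theorem arcMap_natCast (a o : ℕ) {x : ℕ} (hx : x < l + 2) :
    arcMap a l o ((x + 1 : ℕ) : ZMod (l + 3)) = ((a + x : ℕ) : ZMod n) := by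
  rw [arcMap, if_neg (natCast_leg_ne_zero hx), val_natCast_leg hx, Nat.add_sub_cancel]

theorem arcMap_one (a o : ℕ) : arcMap a l o 1 = (a : ZMod n) := by
  simpa using arcMap_natCast (n := n) (l := l) a o (x := 0) (by omega)

theorem natCast_last_leg : ((l + 2 : ℕ) : ZMod (l + 3)) = -1 := by
  rw [eq_neg_iff_add_eq_zero]
  exact_mod_cast ZMod.natCast_self (l + 3)

theorem arcMap_neg_one (a o : ℕ) : arcMap a l o (-1) = ((a + l + 1 : ℕ) : ZMod n) := by
  rw [← natCast_last_leg, arcMap_natCast a o (by omega), add_assoc]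

theorem arcMap_injective {a o d : ℕ} (ho : (o : ZMod n) = ((a + d : ℕ) : ZMod n)) (hld : l + 2 ≤ d)
    (hdn : d < n) : Function.Injective (arcMap a l o : ZMod (l + 3) → ZMod n) := by
  have h1 : ∀ t : ZMod (l + 3), arcMap a l o t
      = ((a + (if t = 0 then d else t.val - 1) : ℕ) : ZMod n) := by
    intro t
    rw [arcMap]
    split_ifs
    · exact ho
    · rfl
  intro t u htu
  rw [h1, h1, ZMod.natCast_eq_natCast_iff] at htu
  have h2 := Nat.ModEq.add_left_cancel' a htu
  have ht := t.val_lt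
  have hu := u.val_lt
  have ht0 := ZMod.val_ne_zero t
  have hu0 := ZMod.val_ne_zero u
  rw [Nat.ModEq, Nat.mod_eq_of_lt (by split_ifs <;> omega),
    Nat.mod_eq_of_lt (by split_ifs <;> omega)] at h2
  by_cases h3 : t = 0 <;> by_cases h4 : u = 0
  · rw [h3, h4]
  · rw [if_pos h3, if_neg h4] at h2
    omega
  · rw [if_neg h3, if_pos h4] at h2
    omega
  · rw [if_neg h3, if_neg h4] at h2
    have := ht0.2 h3
    have := hu0.2 h4
    exact ZMod.val_injective _ (by omega)

theorem exists_natCast_of_free (a o : ℕ) {t : ZMod (l + 3)} (h1 : t ≠ 1) (h2 : t ≠ -1)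
    (h0 : t ≠ 0) : ∃ x : ℕ, arcMap a l o t = (x : ZMod n) ∧ a < x ∧ x < a + l + 1 := by
  refine ⟨a + (t.val - 1), by rw [arcMap, if_neg h0], ?_, ?_⟩
  · have e0 := (ZMod.val_ne_zero t).2 h0
    have e1 : t.val ≠ 1 := fun h => h1 (ZMod.val_injective _ (by rw [h, val_one_leg]))
    omega
  · have e0 := (ZMod.val_ne_zero t).2 h0
    have e1 : t.val ≠ l + 2 := fun h => h2 (ZMod.val_injective _ (by rw [h, val_neg_one_leg]))
    have := t.val_lt
    omega

theorem card_legs : Fintype.card {t : ZMod (l + 3) // t ≠ 1 ∧ t ≠ -1 ∧ t ≠ 0} = l := by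
  rw [Fintype.card_subtype]
  have : (Finset.univ.filter fun t : ZMod (l + 3) => t ≠ 1 ∧ t ≠ -1 ∧ t ≠ 0)
      = ({1, -1, 0} : Finset (ZMod (l + 3)))ᶜ := by
    ext t
    simp
  rw [this, Finset.card_compl, ZMod.card, Finset.card_insert_of_notMem
    (by simp [one_ne_neg_one_leg, zero_ne_one_leg.symm]), Finset.card_pair neg_one_ne_zero_leg]
  rfl

/-! Invariants of the currents. -/

theorem legMomentum_zero (a : ℕ) : legMomentum (n := n) a l 0
    = - ∑ i ∈ Finset.range (l + 2), Pi.single ((a + i : ℕ) : ZMod n) 1 := if_pos rfl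

theorem legMomentum_of_ne (a o : ℕ) {t : ZMod (l + 3)} (ht : t ≠ 0) :
    legMomentum a l t = Pi.single (arcMap a l o t : ZMod n) 1 := by
  rw [legMomentum, if_neg ht, arcMap, if_neg ht]

theorem sum_legMomentum (a : ℕ) : ∑ t, legMomentum (n := n) a l t = 0 := by
  rw [sum_zmod, Finset.sum_range_succ', Nat.cast_zero, legMomentum_zero, ← sub_eq_add_neg,
    sub_eq_zero]
  refine Finset.sum_congr rfl fun x hx => ?_
  rw [Finset.mem_range] at hx
  rw [legMomentum_of_ne a 0 (natCast_leg_ne_zero hx), arcMap_natCast a 0 hx]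

theorem legGram_symm {s : Matrix (ZMod n) (ZMod n) ℂ} (hs : IsMandelstam s) (a : ℕ)
    (t u : ZMod (l + 3)) : legGram s a l t u = legGram s a l u t := by
  have hT : sᵀ = s := by
    ext x y
    exact hs.symm y x
  unfold legGram
  rw [dotProduct_comm, ← Matrix.vecMul_transpose, hT, ← Matrix.dotProduct_mulVec]

theorem legGram_sum (s : Matrix (ZMod n) (ZMod n) ℂ) (a : ℕ) (t : ZMod (l + 3)) :
    ∑ u, legGram s a l t u = 0 := by
  unfold legGram
  rw [← dotProduct_sum, ← Matrix.mulVec_sum, sum_legMomentum, Matrix.mulVec_zero, dotProduct_zero]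

theorem legGram_of_ne (s : Matrix (ZMod n) (ZMod n) ℂ) (a o : ℕ) {t u : ZMod (l + 3)} (ht : t ≠ 0)
    (hu : u ≠ 0) : legGram s a l t u = s (arcMap a l o t) (arcMap a l o u) := by
  unfold legGram
  rw [legMomentum_of_ne a o ht, legMomentum_of_ne a o hu, single_one_dotProduct,
    Matrix.mulVec_single_one, Matrix.col_apply]

theorem naculich_symm {ι : Type*} [Fintype ι] [DecidableEq ι] {G : Matrix ι ι ℂ}
    (hG : ∀ a b, G a b = G b a) (i j k a b : ι) : naculich G i j k a b = naculich G i j k b a := by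
  simp only [naculich, Sym2.eq_swap (a := b), hG b a, eq_comm (a := b)]

theorem naculich_sum {ι : Type*} [Fintype ι] [DecidableEq ι] {G : Matrix ι ι ℂ} {i j k : ι}
    (hij : i ≠ j) (hjk : j ≠ k) (hki : k ≠ i) (hsum : ∀ a, ∑ b, G a b = 0)
    (hdiag : ∀ a, a ≠ i → a ≠ j → a ≠ k → G a a = 0) (a : ι) :
    ∑ b, naculich G i j k a b = 0 := by
  have key : ∀ x y z : ℂ, ∀ (i' j' k' : ι), (∀ b, naculich G i j k a b = G a b
      - (if b = i' then x else 0) + (if b = j' then y else 0) + (if b = k' then z else 0)) →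
      x = y + z → ∑ b, naculich G i j k a b = 0 := by
    intro x y z i' j' k' h hx
    simp only [h, Finset.sum_add_distrib, Finset.sum_sub_distrib, hsum, Finset.sum_ite_eq',
      Finset.mem_univ, if_true, hx]
    ring
  by_cases h1 : a = i
  · subst h1
    refine key (G a a) ((G a a + G j j - G k k) / 2) ((G k k + G a a - G j j) / 2) a j k
      (fun b => ?_) (by ring)
    by_cases b1 : b = a
    · subst b1; simp [naculich, hij, hki.symm]
    by_cases b2 : b = j
    · subst b2; simp [naculich, hij, hij.symm, hjk]
    by_cases b3 : b = k
    · subst b3; simp [naculich, hij, hjk.symm, hki, hki.symm]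
    simp [naculich, b1, b2, b3, Ne.symm b1, hij, hki.symm]
  by_cases h2 : a = j
  · subst h2
    refine key (G a a) ((G i i + G a a - G k k) / 2) ((G a a + G k k - G i i) / 2) a i k
      (fun b => ?_) (by ring)
    by_cases b1 : b = a
    · subst b1; simp [naculich, hij.symm, hjk]
    by_cases b2 : b = i
    · subst b2; simp [naculich, hij, hij.symm, hki.symm]
    by_cases b3 : b = k
    · subst b3; simp [naculich, hij.symm, hjk, hjk.symm, hki]
    simp [naculich, b1, b2, b3, Ne.symm b1, hij.symm, hjk]
  by_cases h3 : a = k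
  · subst h3
    refine key (G a a) ((G a a + G i i - G j j) / 2) ((G j j + G a a - G i i) / 2) a i j
      (fun b => ?_) (by ring)
    by_cases b1 : b = a
    · subst b1; simp [naculich, hjk.symm, hki]
    by_cases b2 : b = i
    · subst b2; simp [naculich, hij, hki.symm, hki, hjk.symm]
    by_cases b3 : b = j
    · subst b3; simp [naculich, hij.symm, hjk, hjk.symm, hki]
    simp [naculich, b1, b2, b3, Ne.symm b1, hjk.symm, hki]
  refine key 0 0 0 a a a (fun b => ?_) (by ring)
  by_cases b1 : b = a
  · subst b1; simp [naculich, hdiag b h1 h2 h3]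
  simp [naculich, Ne.symm b1, h1, h2, h3]

theorem currentInvariants_isMandelstam {s : Matrix (ZMod n) (ZMod n) ℂ} (hs : IsMandelstam s)
    (a l : ℕ) : IsMandelstam (currentInvariants s a l) where
  symm := naculich_symm (legGram_symm hs a) _ _ _
  massless t := if_pos rfl
  conservation := naculich_sum one_ne_neg_one_leg neg_one_ne_zero_leg zero_ne_one_leg
    (legGram_sum s a) fun t _ _ ht => by rw [legGram_of_ne s a 0 ht ht, hs.massless]

theorem currentInvariants_of_free {s : Matrix (ZMod n) (ZMod n) ℂ} (hs : IsMandelstam s)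
    {a o : ℕ} (hinj : Function.Injective (arcMap a l o : ZMod (l + 3) → ZMod n))
    {t : ZMod (l + 3)} (h1 : t ≠ 1) (h2 : t ≠ -1) (h0 : t ≠ 0)
    (hzero : ∀ b, b ∉ Set.range (arcMap a l o : ZMod (l + 3) → ZMod n) →
      s (arcMap a l o t) b = 0) (u : ZMod (l + 3)) :
    currentInvariants s a l t u = s (arcMap a l o t) (arcMap a l o u) := by
  by_cases htu : t = u
  · subst htu
    rw [hs.massless]
    exact if_pos rfl
  have hG : currentInvariants s a l t u = legGram s a l t u := by
    simp [currentInvariants, naculich, htu, h0, h1, h2]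
  rw [hG]
  by_cases hu : u = 0
  · subst hu
    have hsum := hs.conservation (arcMap a l o t)
    rw [← Fintype.sum_of_injective (arcMap a l o) hinj
      (fun u => s (arcMap a l o t) (arcMap a l o u)) _ hzero fun _ => rfl, sum_zmod,
      Finset.sum_range_succ', Nat.cast_zero] at hsum
    rw [legGram, legMomentum_of_ne a o h0, legMomentum_zero, single_one_dotProduct,
      Matrix.mulVec_neg, Matrix.mulVec_sum, Pi.neg_apply, Finset.sum_apply,
      eq_comm, ← sub_eq_zero, sub_neg_eq_add, add_comm, ← hsum]
    congr 1
    refine Finset.sum_congr rfl fun x hx => ?_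
    rw [Finset.mem_range] at hx
    rw [Matrix.mulVec_single_one, Matrix.col_apply, arcMap_natCast a o hx]
  · exact legGram_of_ne s a o h0 hu

theorem parkeTaylorCanonical_arc (c : ZMod n → ℂ × ℂ) (a o : ℕ) :
    parkeTaylorCanonical (c ∘ arcMap a l o : ZMod (l + 3) → ℂ × ℂ)
      = (∏ x ∈ Finset.range (l + 1), (bracket c ((a + x : ℕ) : ZMod n) ((a + x : ℕ) + 1))⁻¹) *
        ((bracket c (o : ZMod n) a)⁻¹ * (bracket c ((a + l + 1 : ℕ) : ZMod n) o)⁻¹) := by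
  rw [parkeTaylorCanonical, prod_zmod, Finset.prod_range_succ', Finset.prod_range_succ]
  have hb : ∀ t u : ZMod (l + 3), bracket (c ∘ arcMap a l o) t u
      = bracket c (arcMap a l o t) (arcMap a l o u) := fun _ _ => rfl
  have e1 : arcMap a l o (((l + 1 + 1 : ℕ) : ZMod (l + 3)) + 1) = (o : ZMod n) := by
    rw [natCast_last_leg, neg_add_cancel, arcMap_zero]
  have e2 : arcMap a l o (((0 : ℕ) : ZMod (l + 3)) + 1) = (a : ZMod n) := by
    rw [Nat.cast_zero, zero_add, arcMap_one]
  rw [hb, hb, e1, e2, natCast_last_leg, arcMap_neg_one, Nat.cast_zero, arcMap_zero, mul_assoc,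
    mul_comm (bracket c _ (o : ZMod n))⁻¹]
  congr 1
  refine Finset.prod_congr rfl fun x hx => ?_
  rw [Finset.mem_range] at hx
  rw [hb, arcMap_natCast a o (by omega), ← Nat.cast_succ, arcMap_natCast a o (by omega)]
  push_cast
  ring_nf

end Arcs

section Split

/-- The first on-shell legs of the three currents. -/
abbrev arcStart (j k : ℕ) : Fin 3 → ℕ := ![1, j, k]

/-- The numbers of particles in the interiors of the three arcs. -/
abbrev arcLength (n j k : ℕ) : Fin 3 → ℕ := ![j - 2, k - j - 1, n - k]

/-- The particles that represent the off-shell legs of the three currents. -/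
abbrev arcOpposite (j k : ℕ) : Fin 3 → ℕ := ![k, 1, j]

variable {n j k : ℕ} [NeZero n]

/-- The particles associated with the legs of the three currents. -/
def arcLabel (n j k : ℕ) (i : Fin 3) : ZMod (arcLength n j k i + 3) → ZMod n :=
  arcMap (arcStart j k i) (arcLength n j k i) (arcOpposite j k i)

/-- The legs of the three currents that represent the particle `1`. -/
def legP (n j k : ℕ) (i : Fin 3) : ZMod (arcLength n j k i + 3) := ((![1, 0, -1] i : ℤ) : ZMod _)

/-- The legs of the three currents that represent the particle `j`. -/
def legQ (n j k : ℕ) (i : Fin 3) : ZMod (arcLength n j k i + 3) := ((![-1, 1, 0] i : ℤ) : ZMod _)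

/-- The legs of the three currents that represent the particle `k`. -/
def legR (n j k : ℕ) (i : Fin 3) : ZMod (arcLength n j k i + 3) := ((![0, -1, 1] i : ℤ) : ZMod _)

theorem fin_three_cases (i : Fin 3) : i = 0 ∨ i = 1 ∨ i = 2 := by
  fin_cases i <;> simp

theorem notMem_legs_iff {l : ℕ} (t : ZMod (l + 3)) :
    t ∉ [1, -1, 0] ↔ (t ≠ 1 ∧ t ≠ -1 ∧ t ≠ 0) := by
  simp

theorem free_iff (i : Fin 3) (t : ZMod (arcLength n j k i + 3)) :
    (t ≠ legP n j k i ∧ t ≠ legQ n j k i ∧ t ≠ legR n j k i) ↔ (t ≠ 1 ∧ t ≠ -1 ∧ t ≠ 0) := by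
  rcases fin_three_cases i with rfl | rfl | rfl <;> simp [legP, legQ, legR] <;> tauto

theorem arcLabel_injective (hj : 1 < j) (hjk : j < k) (hk : k ≤ n) (i : Fin 3) :
    Function.Injective (arcLabel n j k i) := by
  rcases fin_three_cases i with rfl | rfl | rfl
  · refine arcMap_injective (d := k - 1) ?_ (by simp; omega) (by omega)
    have h : 1 + (k - 1) = k := by omega
    simp [h]
  · refine arcMap_injective (d := n + 1 - j) ?_ (by simp; omega) (by omega)
    have h : j + (n + 1 - j) = n + 1 := by omega
    simp [h]
  · refine arcMap_injective (d := n + j - k) ?_ (by simp; omega) (by omega)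
    have h : k + (n + j - k) = n + j := by omega
    simp [h]

theorem arcLabel_zero (i : Fin 3) : arcLabel n j k i 0 = arcOpposite j k i := arcMap_zero _ _

theorem arcLabel_one (i : Fin 3) : arcLabel n j k i 1 = arcStart j k i := arcMap_one _ _

theorem arcLabel_neg_one (i : Fin 3) : arcLabel n j k i (-1)
    = ((arcStart j k i + arcLength n j k i + 1 : ℕ) : ZMod n) := arcMap_neg_one _ _

theorem legs_zero : legP n j k 0 = 1 ∧ legQ n j k 0 = -1 ∧ legR n j k 0 = 0 :=
  ⟨Int.cast_one, by rw [← Int.cast_one, ← Int.cast_neg]; rfl, Int.cast_zero⟩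

theorem legs_one : legP n j k 1 = 0 ∧ legQ n j k 1 = 1 ∧ legR n j k 1 = -1 :=
  ⟨Int.cast_zero, Int.cast_one, by rw [← Int.cast_one, ← Int.cast_neg]; rfl⟩

theorem legs_two : legP n j k 2 = -1 ∧ legQ n j k 2 = 0 ∧ legR n j k 2 = 1 :=
  ⟨by rw [← Int.cast_one, ← Int.cast_neg]; rfl, Int.cast_zero, Int.cast_one⟩

theorem arcLabel_legP (hk : k ≤ n) (i : Fin 3) : arcLabel n j k i (legP n j k i) = 1 := by
  rcases fin_three_cases i with rfl | rfl | rfl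
  · rw [legs_zero.1, arcLabel_one]
    simp
  · rw [legs_one.1, arcLabel_zero]
    simp
  · rw [legs_two.1, arcLabel_neg_one]
    have h : k + (n - k) + 1 = n + 1 := by omega
    simp only [Matrix.cons_val, h]
    simp

theorem arcLabel_legQ (hj : 1 < j) (i : Fin 3) : arcLabel n j k i (legQ n j k i) = j := by
  rcases fin_three_cases i with rfl | rfl | rfl
  · rw [legs_zero.2.1, arcLabel_neg_one]
    have h : 1 + (j - 2) + 1 = j := by omega
    simp only [Matrix.cons_val_zero, h]
  · rw [legs_one.2.1, arcLabel_one]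
    simp
  · rw [legs_two.2.1, arcLabel_zero]
    simp

theorem arcLabel_legR (hjk : j < k) (i : Fin 3) : arcLabel n j k i (legR n j k i) = k := by
  rcases fin_three_cases i with rfl | rfl | rfl
  · rw [legs_zero.2.2, arcLabel_zero]
    simp
  · rw [legs_one.2.2, arcLabel_neg_one]
    have h : j + (k - j - 1) + 1 = k := by omega
    simp only [Matrix.cons_val_one, Matrix.cons_val_zero, h]
  · rw [legs_two.2.2, arcLabel_one]
    simp

theorem interlaces_arcLabel (hj : 1 < j) (hjk : j < k) (hk : k ≤ n) {i i' : Fin 3}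
    (hi : i ≠ i') (t : Free (legP n j k i) (legQ n j k i) (legR n j k i))
    (t' : Free (legP n j k i') (legQ n j k i') (legR n j k i')) :
    Interlaces n j k (arcLabel n j k i t) (arcLabel n j k i' t') ∧
      arcLabel n j k i t ≠ arcLabel n j k i' t' := by
  have bounds : ∀ (i : Fin 3) (t : Free (legP n j k i) (legQ n j k i) (legR n j k i)),
      ∃ x : ℕ, arcLabel n j k i t = (x : ZMod n) ∧ arcStart j k i < x ∧
        x < arcStart j k i + arcLength n j k i + 1 := fun i t => by
    obtain ⟨h1, h2, h0⟩ := (free_iff i t.1).1 t.2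
    exact exists_natCast_of_free _ _ h1 h2 h0
  obtain ⟨x, hx, hx1, hx2⟩ := bounds i t
  obtain ⟨y, hy, hy1, hy2⟩ := bounds i' t'
  rw [hx, hy]
  have hne : x ≠ y → 1 ≤ x → x ≤ n → 1 ≤ y → y ≤ n → (x : ZMod n) ≠ y :=
    fun h a b c d e => h (natCast_zmod_inj a b c d e)
  rcases fin_three_cases i with rfl | rfl | rfl <;> rcases fin_three_cases i' with rfl | rfl | rfl <;>
    simp only [Matrix.cons_val_zero, Matrix.cons_val_one, Matrix.cons_val] at hx1 hx2 hy1 hy2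
  · exact absurd rfl hi
  · exact ⟨⟨x, y, Or.inl ⟨rfl, rfl⟩, by omega⟩, by apply hne <;> omega⟩
  · exact ⟨⟨x, y, Or.inl ⟨rfl, rfl⟩, by omega⟩, by apply hne <;> omega⟩
  · exact ⟨⟨y, x, Or.inr ⟨rfl, rfl⟩, by omega⟩, by apply hne <;> omega⟩
  · exact absurd rfl hi
  · exact ⟨⟨x, y, Or.inl ⟨rfl, rfl⟩, by omega⟩, by apply hne <;> omega⟩
  · exact ⟨⟨y, x, Or.inr ⟨rfl, rfl⟩, by omega⟩, by apply hne <;> omega⟩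
  · exact ⟨⟨y, x, Or.inr ⟨rfl, rfl⟩, by omega⟩, by apply hne <;> omega⟩
  · exact absurd rfl hi

theorem exists_arcLabel (hj : 1 < j) (hjk : j < k) (hk : k ≤ n) (a : ZMod n) :
    ∃ i t, arcLabel n j k i t = a := by
  obtain ⟨x, hx1, hxn, rfl⟩ := exists_natCast_eq a
  have key : ∀ (i : Fin 3), arcStart j k i ≤ x → x ≤ arcStart j k i + arcLength n j k i + 1 →
      ∃ i t, arcLabel n j k i t = (x : ZMod n) := fun i h1 h2 => by
    refine ⟨i, ((x - arcStart j k i + 1 : ℕ) : ZMod _), ?_⟩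
    rw [arcLabel, arcMap_natCast _ _ (by omega), Nat.add_sub_cancel' h1]
  rcases lt_or_ge x j with h | h
  · exact key 0 (by simpa using hx1) (by simp; omega)
  rcases lt_or_ge x k with h' | h'
  · exact key 1 (by simpa using h) (by simp; omega)
  · exact key 2 (by simpa using h') (by simp; omega)

theorem natCast_ne_of_lt {x y : ℕ} (hx : 1 ≤ x) (hxy : x < y) (hy : y ≤ n) :
    (x : ZMod n) ≠ y := fun h => by
  have := natCast_zmod_inj hx (by omega) (by omega) hy h
  omega

/-- On split kinematics, the particles are obtained by gluing the legs of the three currents. -/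
theorem isGluing_arcLabel (hj : 1 < j) (hjk : j < k) (hk : k ≤ n)
    {s : Matrix (ZMod n) (ZMod n) ℂ} (hs : IsMandelstam s) (hsplit : IsSplit j k s) :
    IsGluing s (fun i => currentInvariants s (arcStart j k i) (arcLength n j k i))
      (arcLabel n j k) 1 (j : ZMod n) (k : ZMod n) (legP n j k) (legQ n j k) (legR n j k) := by
  have hzero : ∀ (i i' : Fin 3) (t : Free (legP n j k i) (legQ n j k i) (legR n j k i))
      (t' : Free (legP n j k i') (legQ n j k i') (legR n j k i')), i ≠ i' →
      s (arcLabel n j k i t) (arcLabel n j k i' t') = 0 := fun i i' t t' hi =>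
    hsplit _ _ (interlaces_arcLabel hj hjk hk hi t t').1
  refine
    { mandelstam := hs
      mandelstam_piece := fun i => currentInvariants_isMandelstam hs _ _
      ne_pq := by simpa using natCast_ne_of_lt (n := n) le_rfl hj (by omega)
      ne_qr := natCast_ne_of_lt (by omega) hjk hk
      ne_rp := by simpa using (natCast_ne_of_lt (n := n) le_rfl (hj.trans hjk) hk).symm
      injective := arcLabel_injective hj hjk hk
      map_p := arcLabel_legP hk
      map_q := arcLabel_legQ hj
      map_r := arcLabel_legR hjk
      exists_preimage := fun a => exists_arcLabel hj hjk hk a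
      ne_of_ne := fun i i' t t' hi => (interlaces_arcLabel hj hjk hk hi t t').2
      eq_zero_of_ne := hzero
      agree := fun i t u => ?_ }
  obtain ⟨h1, h2, h0⟩ := (free_iff i t.1).1 t.2
  refine currentInvariants_of_free hs (arcLabel_injective hj hjk hk i) h1 h2 h0 (fun b hb => ?_) u
  obtain ⟨i', t', rfl⟩ := exists_arcLabel hj hjk hk b
  by_cases hi : i = i'
  · subst hi
    exact absurd ⟨t', rfl⟩ hb
  refine hzero i i' t ⟨t', ?_, ?_, ?_⟩ hi
  · rintro rfl
    exact hb ⟨legP n j k i, (arcLabel_legP hk i).trans (arcLabel_legP hk i').symm⟩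
  · rintro rfl
    exact hb ⟨legQ n j k i, (arcLabel_legQ hj i).trans (arcLabel_legQ hj i').symm⟩
  · rintro rfl
    exact hb ⟨legR n j k i, (arcLabel_legR hjk i).trans (arcLabel_legR hjk i').symm⟩

theorem bracket_ne_zero_of_pieces (hj : 1 < j) (hjk : j < k) (hk : k ≤ n)
    {s : Matrix (ZMod n) (ZMod n) ℂ}
    (g : IsGluing s (fun i => currentInvariants s (arcStart j k i) (arcLength n j k i))
      (arcLabel n j k) 1 (j : ZMod n) (k : ZMod n) (legP n j k) (legQ n j k) (legR n j k))
    (hcoll : NoAccidentalCollision j k s) (z : Free (1 : ZMod n) (j : ZMod n) (k : ZMod n) → ℂ)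
    (hz : ∀ i, g.configEquiv z i ∈ solutions
      (currentInvariants s (arcStart j k i) (arcLength n j k i))
      (legP n j k i) (legQ n j k i) (legR n j k i)) (a b : ZMod n) (hab : a ≠ b) :
    bracket (puncture 1 (j : ZMod n) (k : ZMod n) z) a b ≠ 0 := by
  have hni : ∀ a b : ZMod n, a ≠ b → ¬ Interlaces n j k a b →
      bracket (puncture 1 (j : ZMod n) (k : ZMod n) z) a b ≠ 0 := by
    intro a b hab hI
    have common : ∃ i t u, arcLabel n j k i t = a ∧ arcLabel n j k i u = b := by
      obtain ⟨i, t, rfl⟩ := exists_arcLabel hj hjk hk a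
      obtain ⟨i', t', rfl⟩ := exists_arcLabel hj hjk hk b
      by_cases hi : i = i'
      · subst hi
        exact ⟨i, t, t', rfl, rfl⟩
      have special : ∀ (i i' : Fin 3) t,
          ¬ (t ≠ legP n j k i ∧ t ≠ legQ n j k i ∧ t ≠ legR n j k i) →
          ∃ u, arcLabel n j k i' u = arcLabel n j k i t := by
        intro i i' t ht
        rw [not_and_or, not_and_or, not_not, not_not, not_not] at ht
        rcases ht with rfl | rfl | rfl
        · exact ⟨_, (arcLabel_legP hk i').trans (arcLabel_legP hk i).symm⟩
        · exact ⟨_, (arcLabel_legQ hj i').trans (arcLabel_legQ hj i).symm⟩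
        · exact ⟨_, (arcLabel_legR hjk i').trans (arcLabel_legR hjk i).symm⟩
      by_cases h1 : t ≠ legP n j k i ∧ t ≠ legQ n j k i ∧ t ≠ legR n j k i
      · by_cases h2 : t' ≠ legP n j k i' ∧ t' ≠ legQ n j k i' ∧ t' ≠ legR n j k i'
        · exact absurd (interlaces_arcLabel hj hjk hk hi ⟨t, h1⟩ ⟨t', h2⟩).1 hI
        · obtain ⟨u, hu⟩ := special i' i t' h2
          exact ⟨i, t, u, rfl, hu⟩
      · obtain ⟨u, hu⟩ := special i i' t h1
        exact ⟨i', u, t', hu, rfl⟩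
    obtain ⟨i, t, u, rfl, rfl⟩ := common
    have := (hz i).1 t u fun h => hab (by rw [h])
    rwa [g.puncture_configEquiv] at this
  by_cases hI : Interlaces n j k a b
  · exact hcoll z hni (g.gradient_eq_zero hz) a b hI
  · exact hni a b hab hI

/-- In the gauge `(σ_1, σ_j, σ_k) = (0, 1, ∞)` the Parke–Taylor factor is the product of those of
the three currents. -/
theorem parkeTaylorCanonical_eq_prod (hj : 1 < j) (hjk : j < k) (hk : k ≤ n)
    {c : ZMod n → ℂ × ℂ} (h1 : bracket c 1 (j : ZMod n) = -1)
    (h2 : bracket c (j : ZMod n) (k : ZMod n) = -1) (h3 : bracket c (k : ZMod n) 1 = 1) :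
    parkeTaylorCanonical c = ∏ i, parkeTaylorCanonical (c ∘ arcLabel n j k i) := by
  let f : ℕ → ℂ := fun x => (bracket c (x : ZMod n) ((x : ZMod n) + 1))⁻¹
  have hfull : parkeTaylorCanonical c = ∏ x ∈ Finset.Ico 1 (n + 1), f x := by
    rw [parkeTaylorCanonical,
      ← Equiv.prod_comp (Equiv.addLeft (1 : ZMod n)), prod_zmod, Finset.prod_Ico_eq_prod_range]
    refine Finset.prod_congr rfl fun x _ => ?_
    simp [f]
  have harc : ∀ i, parkeTaylorCanonical (c ∘ arcLabel n j k i) = _ := fun i =>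
    parkeTaylorCanonical_arc c (arcStart j k i) (arcOpposite j k i)
  rw [hfull, Fin.prod_univ_three, harc, harc, harc,
    ← Finset.prod_Ico_consecutive f hj.le (by omega : j ≤ n + 1),
    ← Finset.prod_Ico_consecutive f hjk.le (by omega : k ≤ n + 1),
    Finset.prod_Ico_eq_prod_range, Finset.prod_Ico_eq_prod_range, Finset.prod_Ico_eq_prod_range]
  simp only [Matrix.cons_val_zero, Matrix.cons_val_one, Matrix.cons_val]
  have e1 : 1 + (j - 2) + 1 = j := by omega
  have e2 : j + (k - j - 1) + 1 = k := by omega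
  have e3 : ((k + (n - k) + 1 : ℕ) : ZMod n) = 1 := by
    rw [show k + (n - k) + 1 = n + 1 by omega]
    simp
  have l1 : j - 2 + 1 = j - 1 := by omega
  have l2 : k - j - 1 + 1 = k - j := by omega
  have l3 : n - k + 1 = n + 1 - k := by omega
  rw [e1, e2, e3, l1, l2, l3, Nat.cast_one, h1, h2, h3]
  simp only [f]
  ring

theorem parkeTaylor_arcLabel (hj : 1 < j) (hjk : j < k) (hk : k ≤ n)
    {c : ZMod n → ℂ × ℂ} (h1 : bracket c 1 (j : ZMod n) = -1)
    (h2 : bracket c (j : ZMod n) (k : ZMod n) = -1) (h3 : bracket c (k : ZMod n) 1 = 1)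
    (i : Fin 3) : parkeTaylor [1, -1, 0] (c ∘ arcLabel n j k i) = 1 := by
  have hP := arcLabel_legP (j := j) hk i
  have hQ := arcLabel_legQ (n := n) (k := k) hj i
  have hR := arcLabel_legR (n := n) hjk i
  have hpt : parkeTaylor [1, -1, 0] (c ∘ arcLabel n j k i)
      = (bracket c (arcLabel n j k i 1) (arcLabel n j k i (-1)) *
        (bracket c (arcLabel n j k i (-1)) (arcLabel n j k i 0) *
        bracket c (arcLabel n j k i 0) (arcLabel n j k i 1)))⁻¹ := by
    simp [parkeTaylor, bracket]
  rw [hpt]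
  rcases fin_three_cases i with rfl | rfl | rfl
  · rw [legs_zero.1] at hP
    rw [legs_zero.2.1] at hQ
    rw [legs_zero.2.2] at hR
    rw [hP, hQ, hR, h1, h2, h3]
    norm_num
  · rw [legs_one.1] at hP
    rw [legs_one.2.1] at hQ
    rw [legs_one.2.2] at hR
    rw [hP, hQ, hR, h1, h2, h3]
    norm_num
  · rw [legs_two.1] at hP
    rw [legs_two.2.1] at hQ
    rw [legs_two.2.2] at hR
    rw [hP, hQ, hR, h1, h2, h3]
    norm_num

theorem sum_arcLength (hj : 1 < j) (hjk : j < k) (hk : k ≤ n) :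
    ∑ i, arcLength n j k i = n - 3 := by
  rw [Fin.sum_univ_three]
  simp only [Matrix.cons_val_zero, Matrix.cons_val_one, Matrix.cons_val]
  omega

theorem card_free (i : Fin 3) :
    Fintype.card (Free (legP n j k i) (legQ n j k i) (legR n j k i)) = arcLength n j k i :=
  (Fintype.card_congr (Equiv.subtypeEquivRight (free_iff i))).trans card_legs

theorem even_card_free (hn : Even n) (hj : 1 < j) (hjk : j < k) (hk : k ≤ n) {i₀ : Fin 3}
    (hodd : Odd (arcLength n j k i₀)) :
    Even (∑ i : {i // i ≠ i₀},
      Fintype.card (Free (legP n j k i.1) (legQ n j k i.1) (legR n j k i.1))) := by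
  have h := sum_arcLength hj hjk hk
  rw [Fintype.sum_eq_add_sum_subtype_ne _ i₀] at h
  simp only [card_free]
  have h3 : Odd (n - 3) := by
    obtain ⟨m, rfl⟩ := hn
    exact ⟨m - 2, by omega⟩
  rw [← h, Nat.odd_add] at h3
  exact h3.1 hodd

/-- The minor of `A` in the reduced determinant factorises on split kinematics. -/
theorem det_matrixA_split (hn : Even n) (hj : 1 < j) (hjk : j < k) (hk : k ≤ n)
    {s : Matrix (ZMod n) (ZMod n) ℂ} (hs : IsMandelstam s) (hsplit : IsSplit j k s)
    (c : ZMod n → ℂ × ℂ) {i₀ : Fin 3} (hodd : Odd (arcLength n j k i₀)) :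
    (principal (matrixA s c)
        (fun a => a ≠ arcLabel n j k i₀ 1 ∧ a ≠ arcLabel n j k i₀ 0)).det =
      (principal (matrixA (currentInvariants s (arcStart j k i₀) (arcLength n j k i₀))
        (c ∘ arcLabel n j k i₀)) (fun t => t ≠ 1 ∧ t ≠ 0)).det *
      ∏ i : {i // i ≠ i₀},
        (principal (matrixA (currentInvariants s (arcStart j k i) (arcLength n j k i))
          (c ∘ arcLabel n j k i)) (fun t => t ∉ [1, -1, 0])).det := by
  rw [(isGluing_arcLabel hj hjk hk hs hsplit).det_matrixA c i₀ 1 0 (-1)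
    (fun t => by rw [free_iff]; tauto) one_ne_neg_one_leg.symm neg_one_ne_zero_leg
    (even_card_free hn hj hjk hk hodd)]
  congr 1
  refine Finset.prod_congr rfl fun i _ => ?_
  exact det_eq_of_bijective _ _ (Equiv.subtypeEquivRight fun t => by rw [free_iff, notMem_legs_iff])
    (Equiv.bijective _) fun _ _ => rfl

/-- The integrands of the three currents, the one with label `i₀` being an NLSM current. -/
noncomputable def currentIntegrand (s : Matrix (ZMod n) (ZMod n) ℂ) (j k : ℕ) (i₀ i : Fin 3) :
    (ZMod (arcLength n j k i + 3) → ℂ × ℂ) → ℂ :=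
  if i = i₀ then
    nlsmIntegrand (currentInvariants s (arcStart j k i) (arcLength n j k i)) 1 0
  else mixedIntegrand (currentInvariants s (arcStart j k i) (arcLength n j k i)) [1, -1, 0]

theorem nlsmIntegrand_eq_prod (hn : Even n) (hj : 1 < j) (hjk : j < k) (hk : k ≤ n)
    {s : Matrix (ZMod n) (ZMod n) ℂ} (hs : IsMandelstam s) (hsplit : IsSplit j k s)
    {c : ZMod n → ℂ × ℂ} (h1 : bracket c 1 (j : ZMod n) = -1)
    (h2 : bracket c (j : ZMod n) (k : ZMod n) = -1) (h3 : bracket c (k : ZMod n) 1 = 1)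
    {i₀ : Fin 3} (hodd : Odd (arcLength n j k i₀)) :
    nlsmIntegrand s (arcLabel n j k i₀ 1) (arcLabel n j k i₀ 0) c
      = ∏ i, currentIntegrand s j k i₀ i (c ∘ arcLabel n j k i) := by
  rw [nlsmIntegrand, reducedDet, det_matrixA_split hn hj hjk hk hs hsplit c hodd,
    parkeTaylorCanonical_eq_prod hj hjk hk h1 h2 h3, Fintype.prod_eq_mul_prod_subtype_ne _ i₀,
    Fintype.prod_eq_mul_prod_subtype_ne
      (fun i => currentIntegrand s j k i₀ i (c ∘ arcLabel n j k i)) i₀]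
  have hi₀ : currentIntegrand s j k i₀ i₀ (c ∘ arcLabel n j k i₀) = nlsmIntegrand
      (currentInvariants s (arcStart j k i₀) (arcLength n j k i₀)) 1 0 (c ∘ arcLabel n j k i₀) := by
    rw [currentIntegrand, if_pos rfl]
  have hi : ∏ i : {i // i ≠ i₀}, currentIntegrand s j k i₀ i (c ∘ arcLabel n j k i)
      = (∏ i : {i // i ≠ i₀}, parkeTaylorCanonical (c ∘ arcLabel n j k i)) *
        ∏ i : {i // i ≠ i₀},
          (principal (matrixA (currentInvariants s (arcStart j k i) (arcLength n j k i))
            (c ∘ arcLabel n j k i)) (fun t => t ∉ [1, -1, 0])).det := by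
    rw [← Finset.prod_mul_distrib]
    refine Finset.prod_congr rfl fun i _ => ?_
    rw [currentIntegrand, if_neg i.2, mixedIntegrand, parkeTaylor_arcLabel hj hjk hk h1 h2 h3,
      mul_one]
  have hb : bracket (c ∘ arcLabel n j k i₀) 1 0
      = bracket c (arcLabel n j k i₀ 1) (arcLabel n j k i₀ 0) := rfl
  rw [hi₀, hi, nlsmIntegrand, reducedDet, hb]
  ring

theorem chyIntegral_currentIntegrand_gauge {s : Matrix (ZMod n) (ZMod n) ℂ} (hs : IsMandelstam s)
    (hj : 1 < j) (hjk : j < k) (hk : k ≤ n) (hsplit : IsSplit j k s) (i₀ i : Fin 3) :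
    chyIntegral (currentInvariants s (arcStart j k i) (arcLength n j k i))
        (legP n j k i) (legQ n j k i) (legR n j k i) (currentIntegrand s j k i₀ i) =
      if i = i₀ then nlsmCurrent s (arcStart j k i) (arcLength n j k i)
      else mixedCurrent s (arcStart j k i) (arcLength n j k i) := by
  have g := isGluing_arcLabel hj hjk hk hs hsplit
  have hm := currentInvariants_isMandelstam hs (arcStart j k i) (arcLength n j k i)
  rw [currentIntegrand]
  split_ifs
  · exact chyIntegral_nlsmIntegrand_gauge hm (g.ne_PQ i) (g.ne_QR i) (g.ne_RP i)
      one_ne_neg_one_leg neg_one_ne_zero_leg zero_ne_one_leg zero_ne_one_leg.symm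
  · exact chyIntegral_mixedIntegrand_gauge hm (g.ne_PQ i) (g.ne_QR i) (g.ne_RP i)
      one_ne_neg_one_leg neg_one_ne_zero_leg zero_ne_one_leg
      one_ne_neg_one_leg neg_one_ne_zero_leg zero_ne_one_leg

/-- Factorisation of the NLSM amplitude on split kinematics: the current with an even number of
legs is an NLSM current and the other two are mixed. -/
theorem nlsmAmplitude_eq_prod (hn : Even n) (hj : 1 < j) (hjk : j < k) (hk : k ≤ n)
    {s : Matrix (ZMod n) (ZMod n) ℂ} (hs : IsMandelstam s) (hsplit : IsSplit j k s)
    (hcoll : NoAccidentalCollision j k s) {p q r : ZMod n} (hpq : p ≠ q) (hqr : q ≠ r)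
    (hrp : r ≠ p) {u v : ZMod n} (huv : u ≠ v) {i₀ : Fin 3} (hodd : Odd (arcLength n j k i₀)) :
    nlsmAmplitude s p q r u v =
      ∏ i, if i = i₀ then nlsmCurrent s (arcStart j k i) (arcLength n j k i)
        else mixedCurrent s (arcStart j k i) (arcLength n j k i) := by
  have g := isGluing_arcLabel hj hjk hk hs hsplit
  simp only [← chyIntegral_currentIntegrand_gauge hs hj hjk hk hsplit i₀]
  rw [← g.chyIntegral_eq_prod (bracket_ne_zero_of_pieces hj hjk hk g hcoll)
    (nlsmIntegrand s u v)]
  · exact chyIntegral_nlsmIntegrand_gauge hs hpq hqr hrp g.ne_pq g.ne_qr g.ne_rp huv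
  · intro z hz
    obtain ⟨h1, h2, h3⟩ := bracket_gauge g.ne_pq g.ne_qr g.ne_rp z
    rw [← nlsmIntegrand_eq_prod hn hj hjk hk hs hsplit h1 h2 h3 hodd, nlsmIntegrand, nlsmIntegrand,
      reducedDet_eq hs ((mem_solutions_iff hs g.ne_pq g.ne_qr g.ne_rp z).1 hz) huv
        ((arcLabel_injective hj hjk hk i₀).ne zero_ne_one_leg.symm)]

/-- If all three arcs have an odd number of particles in their interior, the NLSM amplitude
vanishes. -/
theorem nlsmAmplitude_eq_zero (hn : Even n) (hj : 1 < j) (hjk : j < k) (hk : k ≤ n)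
    {s : Matrix (ZMod n) (ZMod n) ℂ} (hs : IsMandelstam s) (hsplit : IsSplit j k s)
    {p q r : ZMod n} (hpq : p ≠ q) (hqr : q ≠ r) (hrp : r ≠ p) {u v : ZMod n} (huv : u ≠ v)
    (hodd : ∀ i, Odd (arcLength n j k i)) : nlsmAmplitude s p q r u v = 0 := by
  rw [nlsmAmplitude, chyIntegral]
  refine finsum_mem_eq_zero_of_forall_eq_zero fun z hz => ?_
  have hc := (mem_solutions_iff hs hpq hqr hrp z).1 hz
  have hdet : ∏ i : {i : Fin 3 // i ≠ 0},
      (principal (matrixA (currentInvariants s (arcStart j k i) (arcLength n j k i))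
        (puncture p q r z ∘ arcLabel n j k i)) (fun t => t ∉ [1, -1, 0])).det = 0 := by
    refine Finset.prod_eq_zero (Finset.mem_univ ⟨1, one_ne_zero⟩) (det_of_skew_of_odd _ ?_ ?_)
    · ext a b
      exact congrFun (congrFun (matrixA_transpose (currentInvariants_isMandelstam hs _ _) _) a.1)
        b.1
    · convert hodd 1
      exact (Fintype.card_congr (Equiv.subtypeEquivRight notMem_legs_iff)).trans card_legs
  rw [reducedDet_eq hs hc huv
    ((arcLabel_injective hj hjk hk 0).ne zero_ne_one_leg.symm), reducedDet,
    det_matrixA_split hn hj hjk hk hs hsplit _ (hodd 0), hdet]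
  simp

end Split

end CHY

theorem mainTheorem2 (n : ℕ) [NeZero n] (hn : Even n) (j k : ℕ)
    (hj : 1 < j) (hjk : j < k) (hk : k ≤ n)
    (s : Matrix (ZMod n) (ZMod n) ℂ) (hs : CHY.IsMandelstam s) (hsplit : CHY.IsSplit j k s)
    (p q r : ZMod n) (hpq : p ≠ q) (hqr : q ≠ r) (hrp : r ≠ p)
    (u v : ZMod n) (huv : u ≠ v) :
    (Odd j → Odd k → CHY.nlsmAmplitude s p q r u v = 0) ∧
    (CHY.NoAccidentalCollision j k s →
      (Odd j → Even k → CHY.nlsmAmplitude s p q r u v =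
        CHY.nlsmCurrent s 1 (j - 2) * CHY.mixedCurrent s j (k - j - 1) *
          CHY.mixedCurrent s k (n - k)) ∧
      (Even j → Even k → CHY.nlsmAmplitude s p q r u v =
        CHY.mixedCurrent s 1 (j - 2) * CHY.nlsmCurrent s j (k - j - 1) *
          CHY.mixedCurrent s k (n - k)) ∧
      (Even j → Odd k → CHY.nlsmAmplitude s p q r u v =
        CHY.mixedCurrent s 1 (j - 2) * CHY.mixedCurrent s j (k - j - 1) *
          CHY.nlsmCurrent s k (n - k))) := by
  refine ⟨fun hj' hk' => ?_, fun hcoll => ⟨fun hj' hk' => ?_, fun hj' hk' => ?_, fun hj' hk' => ?_⟩⟩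
  · refine CHY.nlsmAmplitude_eq_zero hn hj hjk hk hs hsplit hpq hqr hrp huv fun i => ?_
    rcases CHY.fin_three_cases i with rfl | rfl | rfl <;>
      simp only [Matrix.cons_val_zero, Matrix.cons_val_one, Matrix.cons_val] <;> grind
  · have h := CHY.nlsmAmplitude_eq_prod hn hj hjk hk hs hsplit hcoll hpq hqr hrp huv (i₀ := 0)
      (by simp only [Matrix.cons_val_zero]; grind)
    rw [h, Fin.prod_univ_three]
    simp
  · have h := CHY.nlsmAmplitude_eq_prod hn hj hjk hk hs hsplit hcoll hpq hqr hrp huv (i₀ := 1)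
      (by simp only [Matrix.cons_val_one, Matrix.cons_val_zero]; grind)
    rw [h, Fin.prod_univ_three]
    simp
  · have h := CHY.nlsmAmplitude_eq_prod hn hj hjk hk hs hsplit hcoll hpq hqr hrp huv (i₀ := 2)
      (by simp only [Matrix.cons_val]; grind)
    rw [h, Fin.prod_univ_three]
    simp
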